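/- Theorem 1.1. For every integer $n \ge 1$ there is a constant $C = C(n)$ such that the following holds. Let $r > 0$, let $B_s \subset \mathbf{R}^n$ denote the open ball of radius $s$ centered at the origin, and let $u : B_{\sqrt{2n+1}\, r} \times [0, r^2] \to \mathbf{R}$ be a function whose graph flows by mean curvature, i.e. $u$ is continuous on $B_{\sqrt{2n+1}\, r} \times [0, r^2]$, smooth on $B_{\sqrt{2n+1}\, r} \times (0, r^2)$, and there satisfies $$u_t = (1 + |du|^2)^{1/2}\, \operatorname{div}\left( \frac{du}{(1 + |du|^2)^{1/2}} \right),$$ where $du$ is the gradient and $\operatorname{div}$ the divergence in the space variable $x \in \mathbf{R}^n$. Suppose that $\|u(\cdot,0)\|_\infty = \sup_{x \in B_{\sqrt{2n+1}\, r}} |u(x,0)|$ is finite. Then $$\log |du|\left(0, \tfrac{r^2}{4n}\right) \le C \left(1 + r^{-1} \|u(\cdot,0)\|_\infty\right)^2$$ (the left side is read as $-\infty$, so that nothing is claimed, if $du(0, r^2/(4n)) = 0$). -/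

import Mathlib

open scoped ContDiff

noncomputable section

/-- The Euclidean divergence `∑ i, ∂ᵢ Fᵢ` of a vector field on `ℝⁿ`. -/
def euclideanDiv {n : ℕ}
    (F : EuclideanSpace ℝ (Fin n) → EuclideanSpace ℝ (Fin n))
    (x : EuclideanSpace ℝ (Fin n)) : ℝ :=
  ∑ i : Fin n, (fderiv ℝ F x (EuclideanSpace.single i 1)) i

/-- `√(1 + |df|²) * div (df / √(1 + |df|²))`, the right-hand side of the mean curvature flow
equation for graphs. -/
def graphMeanCurvatureOp {n : ℕ} (f : EuclideanSpace ℝ (Fin n) → ℝ)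
    (x : EuclideanSpace ℝ (Fin n)) : ℝ :=
  Real.sqrt (1 + ‖gradient f x‖ ^ 2) *
    euclideanDiv (fun y => (Real.sqrt (1 + ‖gradient f y‖ ^ 2))⁻¹ • gradient f y) x

/-- The graph of `u : U × [0, T] → ℝ` (`U` an open subset of `ℝⁿ`) flows by mean curvature:
`u` is continuous on `U × [0, T]`, and on the open set `U × (0, T)` it is smooth, jointly in space
and time, and solves `u_t = √(1 + |du|²) * div (du / √(1 + |du|²))`.
Every `u` that is smooth on `U × [0, T]` and solves the equation there is included; no control of
derivatives as `t → 0`, and no control of `u` near the lateral boundary, is demanded.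
Values of `u` outside `U × [0, T]` are irrelevant. -/
structure GraphFlowsByMeanCurvature {n : ℕ} (U : Set (EuclideanSpace ℝ (Fin n))) (T : ℝ)
    (u : EuclideanSpace ℝ (Fin n) → ℝ → ℝ) : Prop where
  continuousOn : ContinuousOn (fun p : EuclideanSpace ℝ (Fin n) × ℝ => u p.1 p.2)
    (U ×ˢ Set.Icc 0 T)
  smooth : ContDiffOn ℝ ∞ (fun p : EuclideanSpace ℝ (Fin n) × ℝ => u p.1 p.2)
    (U ×ˢ Set.Ioo 0 T)
  equation : ∀ x ∈ U, ∀ t ∈ Set.Ioo (0 : ℝ) T,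
    deriv (fun s => u x s) t = graphMeanCurvatureOp (fun y => u y t) x

/-- The supremum of `|f|` over `s` (the sup norm when `f` is bounded on a nonempty `s`). -/
def supNormOn {n : ℕ} (s : Set (EuclideanSpace ℝ (Fin n)))
    (f : EuclideanSpace ℝ (Fin n) → ℝ) : ℝ :=
  sSup ((fun x => |f x|) '' s)

end

/-! Let `v = √(1 + |Du|²)`. On the moving graph the natural heat operator is `∂_t - g^{ij} ∂_i ∂_j`,
with `g^{-1} = 1 - Du ⊗ Du / v²`. It kills `u`, takes a bounded value on `|x|²`, and makes `1/v` a
supersolution. The proof is a maximum principle for a localized `v`.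

The cutoff is `e^{Kφ} - 1` with `φ = A t - B|x|² - c u + d`. Where `v` is large, the term `c u`
forces the tangential gradient of `φ` to satisfy `|∇φ|² ≥ c²/2` (`sum_dirDeriv_localizer_ge`). Since
the heat operator of `φ` is at most `A + 2nB`, any `K` above `2(A + 2nB)/c²` makes `e^{Kφ} - 1` a
strict subsolution there. At a maximum of `(e^{Kφ} - 1) v`, with value `λ > 0`, the function `e^{Kφ}
- 1 - λ/v` touches zero from below, which is impossible if `v` is large
(`gradient_bound_of_isMaxOn`). Comparing the maximum with the centre bounds `v` there by a multiple
of `e^K` (`interior_gradient_estimate`). Here `A` and `B` are of order `r⁻²` and `1/c` is of the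
order of the oscillation of `u`, so `K` is quadratic in oscillation over `r`, and so is the bound on
`log |Du|`.

The oscillation is controlled by shrinking spheres. A sphere lying above or below the initial graph
stays disjoint from it, so `|u|` stays below `sup |u(·,0)| + 3r/2` on the smaller cylinder
(`sphere_barrier`, `abs_lt_of_sphere_barriers`). -/

open Filter Topology

/-! ### Directional derivatives, heat operators and the parabolic second derivative test -/

section Calculus

variable {V : Type*} [NormedAddCommGroup V] [NormedSpace ℝ V]

/-- The derivative of `f` in the direction `a`, as a function of the point. -/
noncomputable def dirDeriv (a : V) (f : V → ℝ) (z : V) : ℝ := fderiv ℝ f z a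

theorem ContDiffOn.differentiableAt_of_isOpen {Ω : Set V} (hΩ : IsOpen Ω) {f : V → ℝ}
    (hf : ContDiffOn ℝ ∞ f Ω) {z : V} (hz : z ∈ Ω) : DifferentiableAt ℝ f z :=
  (hf.contDiffAt (hΩ.mem_nhds hz)).differentiableAt (by simp)

theorem ContDiffOn.contDiffOn_dirDeriv {Ω : Set V} (hΩ : IsOpen Ω) {f : V → ℝ}
    (hf : ContDiffOn ℝ ∞ f Ω) (a : V) : ContDiffOn ℝ ∞ (dirDeriv a f) Ω :=
  (hf.fderiv_of_isOpen hΩ (by simp)).clm_apply contDiffOn_const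

theorem dirDeriv_dirDeriv {Ω : Set V} (hΩ : IsOpen Ω) {f : V → ℝ}
    (hf : ContDiffOn ℝ ∞ f Ω) {z : V} (hz : z ∈ Ω) (a b : V) :
    dirDeriv a (dirDeriv b f) z = fderiv ℝ (fderiv ℝ f) z a b := by
  have h : DifferentiableAt ℝ (fderiv ℝ f) z :=
    ((hf.fderiv_of_isOpen hΩ (m := 1) (by norm_cast)).contDiffAt
      (hΩ.mem_nhds hz)).differentiableAt (by simp)
  have := h.hasFDerivAt.clm_apply (hasFDerivAt_const b z)
  unfold dirDeriv
  rw [this.fderiv]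
  simp

theorem dirDeriv_comm {Ω : Set V} (hΩ : IsOpen Ω) {f : V → ℝ}
    (hf : ContDiffOn ℝ ∞ f Ω) {z : V} (hz : z ∈ Ω) (a b : V) :
    dirDeriv a (dirDeriv b f) z = dirDeriv b (dirDeriv a f) z := by
  rw [dirDeriv_dirDeriv hΩ hf hz, dirDeriv_dirDeriv hΩ hf hz]
  exact (hf.contDiffAt (hΩ.mem_nhds hz)).isSymmSndFDerivAt (by simp; norm_cast) a b

theorem dirDeriv_congr {Ω : Set V} (hΩ : IsOpen Ω) {f g : V → ℝ} (h : Set.EqOn f g Ω)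
    {z : V} (hz : z ∈ Ω) (a : V) : dirDeriv a f z = dirDeriv a g z := by
  unfold dirDeriv
  rw [(h.eventuallyEq_of_mem (hΩ.mem_nhds hz)).fderiv_eq]

theorem hasDerivAt_line (z a : V) (s : ℝ) : HasDerivAt (fun s : ℝ => z + s • a) a s := by
  simpa using ((hasDerivAt_id s).smul_const a).const_add z

theorem DifferentiableAt.hasDerivAt_dirDeriv {f : V → ℝ} {z a : V} {s : ℝ}
    (hf : DifferentiableAt ℝ f (z + s • a)) :
    HasDerivAt (fun s : ℝ => f (z + s • a)) (dirDeriv a f (z + s • a)) s :=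
  hf.hasFDerivAt.comp_hasDerivAt s (hasDerivAt_line z a s)

theorem ContDiffOn.hasDerivAt_dirDeriv {Ω : Set V} (hΩ : IsOpen Ω) {f : V → ℝ}
    (hf : ContDiffOn ℝ ∞ f Ω) {z : V} (hz : z ∈ Ω) (a : V) :
    HasDerivAt (fun s : ℝ => f (z + s • a)) (dirDeriv a f z) 0 := by
  have h := (hf.differentiableAt_of_isOpen hΩ hz)
  have h2 : DifferentiableAt ℝ f (z + (0 : ℝ) • a) := by simpa using h
  simpa using h2.hasDerivAt_dirDeriv

theorem dirDeriv_eq_of_hasDerivAt {f : V → ℝ} {z a : V} (hf : DifferentiableAt ℝ f z) {c : ℝ}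
    (h : HasDerivAt (fun s : ℝ => f (z + s • a)) c 0) : dirDeriv a f z = c := by
  have h2 : DifferentiableAt ℝ f (z + (0 : ℝ) • a) := by simpa using hf
  have h3 := h2.hasDerivAt_dirDeriv
  simp only [zero_smul, add_zero] at h3
  exact h3.unique h

theorem dirDeriv_sub {f g : V → ℝ} {z : V} (hf : DifferentiableAt ℝ f z)
    (hg : DifferentiableAt ℝ g z) (a : V) :
    dirDeriv a (fun y => f y - g y) z = dirDeriv a f z - dirDeriv a g z := by
  simp [dirDeriv, fderiv_fun_sub hf hg]

theorem dirDeriv_add {f g : V → ℝ} {z : V} (hf : DifferentiableAt ℝ f z)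
    (hg : DifferentiableAt ℝ g z) (a : V) :
    dirDeriv a (fun y => f y + g y) z = dirDeriv a f z + dirDeriv a g z := by
  simp [dirDeriv, fderiv_fun_add hf hg]

theorem dirDeriv_const_mul {f : V → ℝ} {z : V} (hf : DifferentiableAt ℝ f z) (c : ℝ) (a : V) :
    dirDeriv a (fun y => c * f y) z = c * dirDeriv a f z := by
  simp [dirDeriv, fderiv_const_mul hf]

theorem dirDeriv_mul {f g : V → ℝ} {z : V} (hf : DifferentiableAt ℝ f z)
    (hg : DifferentiableAt ℝ g z) (a : V) :
    dirDeriv a (fun y => f y * g y) z = dirDeriv a f z * g z + f z * dirDeriv a g z := by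
  simp [dirDeriv, fderiv_fun_mul hf hg]; ring

theorem dirDeriv_comp {g : ℝ → ℝ} {f : V → ℝ} {z : V} {g' : ℝ} (hg : HasDerivAt g g' (f z))
    (hf : DifferentiableAt ℝ f z) (a : V) :
    dirDeriv a (fun y => g (f y)) z = g' * dirDeriv a f z := by
  have := hg.comp_hasFDerivAt z hf.hasFDerivAt
  have h2 : fderiv ℝ (fun y => g (f y)) z = g' • fderiv ℝ f z := this.fderiv
  simp [dirDeriv, h2]

/-- A one-dimensional second derivative test. -/
theorem deriv2_nonpos_of_isLocalMax {h h' : ℝ → ℝ} {h'' : ℝ}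
    (hd : ∀ᶠ s in 𝓝 (0 : ℝ), HasDerivAt h (h' s) s) (hd2 : HasDerivAt h' h'' 0)
    (hm : IsLocalMax h 0) : h'' ≤ 0 := by
  -- A positive second derivative would make 0 a local minimum as well, so `h` would be locally
  -- constant and its second derivative zero.
  by_contra! hpos
  have e1 : deriv h =ᶠ[𝓝 0] h' := hd.mono fun s hs => hs.deriv
  have e2 : deriv (deriv h) 0 = h'' := by rw [e1.deriv_eq]; exact hd2.deriv
  have hmin : IsLocalMin h 0 := isLocalMin_of_deriv_deriv_pos (by rw [e2]; exact hpos)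
    hm.deriv_eq_zero hd.self_of_nhds.continuousAt
  have e3 : h =ᶠ[𝓝 0] fun _ => h 0 := by
    filter_upwards [hmin, hm] with s h1 h2 using le_antisymm h2 h1
  have e4 : deriv h =ᶠ[𝓝 0] fun _ => 0 := by
    filter_upwards [e3.eventuallyEq_nhds] with s hs
    rw [hs.deriv_eq]; simp
  rw [e4.deriv_eq] at e2
  simp at e2
  exact hpos.ne e2

theorem deriv_nonneg_of_le_left {f : ℝ → ℝ} {f' a : ℝ} (hf : HasDerivAt f f' a)
    (h : ∀ᶠ s in 𝓝[<] a, f s ≤ f a) : 0 ≤ f' := by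
  have h1 := (hasDerivAt_iff_tendsto_slope.1 hf).mono_left
    (nhdsWithin_mono a (s := Set.Iio a) (fun x hx => ne_of_lt hx))
  refine ge_of_tendsto h1 ?_
  filter_upwards [h, self_mem_nhdsWithin] with s hs hs2
  rw [slope_def_field]
  exact div_nonneg_of_nonpos (by linarith) (by linarith [Set.mem_Iio.1 hs2])

/-- `∂_τ f - ∑ₖ ∂_{bₖ}² f`. -/
noncomputable def heatOp {ι : Type*} [Fintype ι] (τ : V) (b : ι → V) (f : V → ℝ) (z : V) : ℝ :=
  dirDeriv τ f z - ∑ k, dirDeriv (b k) (dirDeriv (b k) f) z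

variable {ι : Type*} [Fintype ι]

theorem heatOp_sub {Ω : Set V} (hΩ : IsOpen Ω) {f g : V → ℝ}
    (hf : ContDiffOn ℝ ∞ f Ω) (hg : ContDiffOn ℝ ∞ g Ω) {z : V} (hz : z ∈ Ω) (τ : V) (b : ι → V) :
    heatOp τ b (fun y => f y - g y) z = heatOp τ b f z - heatOp τ b g z := by
  have h2 : ∀ a, dirDeriv a (dirDeriv a (fun y => f y - g y)) z =
      dirDeriv a (dirDeriv a f) z - dirDeriv a (dirDeriv a g) z := by
    intro a
    rw [dirDeriv_congr hΩ (g := fun y => dirDeriv a f y - dirDeriv a g y) _ hz,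
      dirDeriv_sub ((hf.contDiffOn_dirDeriv hΩ a).differentiableAt_of_isOpen hΩ hz)
        ((hg.contDiffOn_dirDeriv hΩ a).differentiableAt_of_isOpen hΩ hz)]
    intro y hy
    exact dirDeriv_sub (hf.differentiableAt_of_isOpen hΩ hy) (hg.differentiableAt_of_isOpen hΩ hy) a
  unfold heatOp
  rw [dirDeriv_sub (hf.differentiableAt_of_isOpen hΩ hz) (hg.differentiableAt_of_isOpen hΩ hz)]
  simp only [h2, Finset.sum_sub_distrib]
  ring

theorem heatOp_add {Ω : Set V} (hΩ : IsOpen Ω) {f g : V → ℝ}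
    (hf : ContDiffOn ℝ ∞ f Ω) (hg : ContDiffOn ℝ ∞ g Ω) {z : V} (hz : z ∈ Ω) (τ : V) (b : ι → V) :
    heatOp τ b (fun y => f y + g y) z = heatOp τ b f z + heatOp τ b g z := by
  have h := heatOp_sub hΩ (hf.add hg) hg hz τ b
  simp only [add_sub_cancel_right] at h
  linarith

/-- The term in `g''` drives both uses: it makes the exponential cutoff a strict subsolution and `(1
+ w²)^{-1/2}` a supersolution. -/
theorem heatOp_comp {Ω : Set V} (hΩ : IsOpen Ω) {f : V → ℝ} (hf : ContDiffOn ℝ ∞ f Ω)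
    {g g' : ℝ → ℝ} {g'' : ℝ} {z : V} (hz : z ∈ Ω) (hg : ∀ s, HasDerivAt g (g' s) s)
    (hg' : HasDerivAt g' g'' (f z)) (τ : V) (b : ι → V) :
    heatOp τ b (fun y => g (f y)) z =
      g' (f z) * heatOp τ b f z - g'' * ∑ k, dirDeriv (b k) f z ^ 2 := by
  have hd := fun {y} (hy : y ∈ Ω) => hf.differentiableAt_of_isOpen hΩ hy
  have h2 : ∀ a, dirDeriv a (dirDeriv a (fun y => g (f y))) z =
      g'' * dirDeriv a f z ^ 2 + g' (f z) * dirDeriv a (dirDeriv a f) z := by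
    intro a
    have hd2 : DifferentiableAt ℝ (fun y => g' (f y)) z :=
      (hg'.comp_hasFDerivAt z (hd hz).hasFDerivAt).differentiableAt
    rw [dirDeriv_congr hΩ (g := fun y => g' (f y) * dirDeriv a f y)
      (fun y hy => dirDeriv_comp (hg _) (hd hy) a) hz,
      dirDeriv_mul hd2 ((hf.contDiffOn_dirDeriv hΩ a).differentiableAt_of_isOpen hΩ hz),
      dirDeriv_comp hg' (hd hz)]
    ring
  unfold heatOp
  rw [dirDeriv_comp (hg _) (hd hz)]
  simp only [h2, Finset.sum_add_distrib, ← Finset.mul_sum]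
  ring

theorem heatOp_const_mul {Ω : Set V} (hΩ : IsOpen Ω) {f : V → ℝ} (hf : ContDiffOn ℝ ∞ f Ω)
    {z : V} (hz : z ∈ Ω) (c : ℝ) (τ : V) (b : ι → V) :
    heatOp τ b (fun y => c * f y) z = c * heatOp τ b f z := by
  simpa using heatOp_comp hΩ hf (g := fun s => c * s) (g' := fun _ => c) hz
    (fun s => by simpa using (hasDerivAt_id s).const_mul c) (hasDerivAt_const _ _) τ b

theorem heatOp_add_const (f : V → ℝ) (z : V) (c : ℝ) (τ : V) (b : ι → V) :
    heatOp τ b (fun y => f y + c) z = heatOp τ b f z := by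
  have : ∀ a, dirDeriv a (fun y => f y + c) = dirDeriv a f := by
    intro a; ext y; simp [dirDeriv]
  simp [heatOp, this]

/-- Only earlier times are compared, so that the maximum may lie at the final time. -/
theorem heatOp_nonneg_of_parabolic_max {Ω : Set V} (hΩ : IsOpen Ω) {f : V → ℝ}
    (hf : ContDiffOn ℝ ∞ f Ω) {z : V} (hz : z ∈ Ω) (τ : V) (b : ι → V)
    (hτ : ∀ᶠ s in 𝓝[<] (0 : ℝ), f (z + s • τ) ≤ f z)
    (hb : ∀ k, ∀ᶠ s in 𝓝 (0 : ℝ), f (z + s • b k) ≤ f z) : 0 ≤ heatOp τ b f z := by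
  have h1 : 0 ≤ dirDeriv τ f z :=
    deriv_nonneg_of_le_left (f := fun s => f (z + s • τ)) (hf.hasDerivAt_dirDeriv hΩ hz τ)
      (by simpa using hτ)
  have h2 : ∀ k, dirDeriv (b k) (dirDeriv (b k) f) z ≤ 0 := by
    intro k
    refine deriv2_nonpos_of_isLocalMax (h := fun s => f (z + s • b k)) ?_
      ((hf.contDiffOn_dirDeriv hΩ (b k)).hasDerivAt_dirDeriv hΩ hz (b k)) ?_
    · have hc : Tendsto (fun s : ℝ => z + s • b k) (𝓝 0) (𝓝 z) := by
        have := (hasDerivAt_line z (b k) 0).continuousAt.tendsto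
        simpa using this
      filter_upwards [hc.eventually (hΩ.mem_nhds hz)] with s hs
      exact (hf.differentiableAt_of_isOpen hΩ hs).hasDerivAt_dirDeriv
    · filter_upwards [hb k] with s hs
      simpa using hs
  have h3 := Finset.sum_nonpos (s := Finset.univ) fun k _ => h2 k
  unfold heatOp
  linarith

end Calculus

/-! ### The inverse metric of a graph and its heat operator -/

section Graph

variable {n : ℕ}

/-- The `i`-th coordinate direction in space, as a direction in space-time. -/
noncomputable def spaceDir (i : Fin n) : EuclideanSpace ℝ (Fin n) × ℝ :=
  (EuclideanSpace.single i 1, 0)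

/-- The time direction in space-time. -/
def timeDir : EuclideanSpace ℝ (Fin n) × ℝ := (0, 1)

/-- The gradient in the space variable of a function on space-time. -/
noncomputable def spaceGrad (f : EuclideanSpace ℝ (Fin n) × ℝ → ℝ)
    (z : EuclideanSpace ℝ (Fin n) × ℝ) : EuclideanSpace ℝ (Fin n) :=
  WithLp.toLp 2 fun i => dirDeriv (spaceDir i) f z

theorem map_eq_sum_single {F : Type*} [AddCommGroup F] [Module ℝ F]
    (ℓ : EuclideanSpace ℝ (Fin n) →ₗ[ℝ] F)
    (y : EuclideanSpace ℝ (Fin n)) : ℓ y = ∑ i, y i • ℓ (EuclideanSpace.single i 1) := by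
  have h := (EuclideanSpace.basisFun (Fin n) ℝ).sum_repr y
  conv_lhs => rw [← h]
  simp

theorem dirDeriv_space (f : EuclideanSpace ℝ (Fin n) × ℝ → ℝ) (z : EuclideanSpace ℝ (Fin n) × ℝ)
    (y : EuclideanSpace ℝ (Fin n)) :
    dirDeriv (y, (0 : ℝ)) f z = ∑ i, y i * dirDeriv (spaceDir i) f z := by
  have := map_eq_sum_single ((fderiv ℝ f z).toLinearMap ∘ₗ LinearMap.inl ℝ _ ℝ) y
  simpa [dirDeriv, spaceDir] using this

theorem dirDeriv_space_eq_inner (f : EuclideanSpace ℝ (Fin n) × ℝ → ℝ)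
    (z : EuclideanSpace ℝ (Fin n) × ℝ) (y : EuclideanSpace ℝ (Fin n)) :
    dirDeriv (y, (0 : ℝ)) f z = inner ℝ y (spaceGrad f z) := by
  rw [dirDeriv_space, PiLp.inner_apply]
  simp [spaceGrad, mul_comm]

/-- Vectors `bₖ` with `∑ₖ bₖ ⊗ bₖ = 1 - P ⊗ P / (1 + |P|²)`, the inverse metric of a graph with
gradient `P`. -/
noncomputable def graphFrame (P : EuclideanSpace ℝ (Fin n)) (k : Fin n) :
    EuclideanSpace ℝ (Fin n) :=
  EuclideanSpace.single k 1 -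
    ((√(1 + ‖P‖ ^ 2) * (√(1 + ‖P‖ ^ 2) + 1))⁻¹ * P k) • P

/-- The frame consists of the columns of the symmetric square root of the inverse metric. Writing
the elliptic part as a sum of squares of fixed directions lets the one-dimensional second derivative
test apply to each. -/
theorem sum_graphFrame (P : EuclideanSpace ℝ (Fin n))
    (B : EuclideanSpace ℝ (Fin n) →ₗ[ℝ] EuclideanSpace ℝ (Fin n) →ₗ[ℝ] ℝ) :
    ∑ k, B (graphFrame P k) (graphFrame P k) =
      ∑ k, B (EuclideanSpace.single k 1) (EuclideanSpace.single k 1) -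
        (1 + ‖P‖ ^ 2)⁻¹ * B P P := by
  set v := √(1 + ‖P‖ ^ 2) with hv
  have hv2 : v ^ 2 = 1 + ‖P‖ ^ 2 := Real.sq_sqrt (by positivity)
  have hv0 : 0 < v := Real.sqrt_pos.2 (by positivity)
  set κ := (v * (v + 1))⁻¹ with hκ
  have h1 : B P P = ∑ k, P k * B (EuclideanSpace.single k 1) P := by
    conv_lhs => rw [map_eq_sum_single B P]
    simp
  have h2 : B P P = ∑ k, P k * B P (EuclideanSpace.single k 1) := by
    rw [map_eq_sum_single (B P) P]; simp
  have h3 : ∑ k, P k ^ 2 = v ^ 2 - 1 := by rw [hv2, EuclideanSpace.real_norm_sq_eq]; ring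
  have h4 : ∀ k, B (graphFrame P k) (graphFrame P k) =
      B (EuclideanSpace.single k 1) (EuclideanSpace.single k 1)
      - κ * (P k * B (EuclideanSpace.single k 1) P) - κ * (P k * B P (EuclideanSpace.single k 1))
      + κ ^ 2 * B P P * P k ^ 2 := by
    intro k
    simp only [graphFrame, map_sub, map_smul, LinearMap.sub_apply, LinearMap.smul_apply,
      smul_eq_mul, ← hv, ← hκ]
    ring
  simp only [h4, Finset.sum_add_distrib, Finset.sum_sub_distrib, ← Finset.mul_sum, ← h1, ← h2, h3]
  rw [← hv2]
  -- As `|P|² = v² - 1`, this says that `1 - κ P ⊗ P` squares to `1 - v⁻² P ⊗ P`.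
  have : κ ^ 2 * (v ^ 2 - 1) - 2 * κ = - (v ^ 2)⁻¹ := by
    rw [hκ]; field_simp; ring
  linear_combination (B P P) * this

theorem sum_graphFrame_mul (P : EuclideanSpace ℝ (Fin n))
    (ℓ ℓ' : EuclideanSpace ℝ (Fin n) →ₗ[ℝ] ℝ) :
    ∑ k, ℓ (graphFrame P k) * ℓ' (graphFrame P k) =
      ∑ k, ℓ (EuclideanSpace.single k 1) * ℓ' (EuclideanSpace.single k 1) -
        (1 + ‖P‖ ^ 2)⁻¹ * (ℓ P * ℓ' P) :=
  sum_graphFrame P (LinearMap.mk₂ ℝ (fun x y => ℓ x * ℓ' y)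
    (by intros; simp; ring) (by intros; simp; ring) (by intros; simp; ring)
    (by intros; simp; ring))

theorem sum_dirDeriv_graphFrame_mul (P : EuclideanSpace ℝ (Fin n))
    (f g : EuclideanSpace ℝ (Fin n) × ℝ → ℝ) (z : EuclideanSpace ℝ (Fin n) × ℝ) :
    ∑ k, dirDeriv (graphFrame P k, (0 : ℝ)) f z * dirDeriv (graphFrame P k, (0 : ℝ)) g z =
      inner ℝ (spaceGrad f z) (spaceGrad g z) -
        (1 + ‖P‖ ^ 2)⁻¹ * (inner ℝ P (spaceGrad f z) * inner ℝ P (spaceGrad g z)) := by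
  have := sum_graphFrame_mul P ((fderiv ℝ f z).toLinearMap ∘ₗ LinearMap.inl ℝ _ ℝ)
    ((fderiv ℝ g z).toLinearMap ∘ₗ LinearMap.inl ℝ _ ℝ)
  rw [← dirDeriv_space_eq_inner f z P, ← dirDeriv_space_eq_inner g z P, PiLp.inner_apply]
  simpa only [dirDeriv, spaceDir, spaceGrad, mul_comm, LinearMap.comp_apply, LinearMap.inl_apply,
    ContinuousLinearMap.coe_coe, RCLike.inner_apply, conj_trivial] using this

theorem sum_dirDeriv_graphFrame_sq {f : EuclideanSpace ℝ (Fin n) × ℝ → ℝ}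
    {Ω : Set (EuclideanSpace ℝ (Fin n) × ℝ)} (hΩ : IsOpen Ω) (hf : ContDiffOn ℝ ∞ f Ω)
    {z : EuclideanSpace ℝ (Fin n) × ℝ} (hz : z ∈ Ω) (P : EuclideanSpace ℝ (Fin n)) :
    ∑ k, dirDeriv (graphFrame P k, (0 : ℝ)) (dirDeriv (graphFrame P k, (0 : ℝ)) f) z =
      ∑ k, dirDeriv (spaceDir k) (dirDeriv (spaceDir k) f) z -
        (1 + ‖P‖ ^ 2)⁻¹ *
          ∑ i, ∑ j, P i * P j * dirDeriv (spaceDir i) (dirDeriv (spaceDir j) f) z := by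
  simp only [dirDeriv_dirDeriv hΩ hf hz]
  let B := (LinearMap.mk₂ ℝ
    (fun x y => fderiv ℝ (fderiv ℝ f) z (LinearMap.inl ℝ _ ℝ x) (LinearMap.inl ℝ _ ℝ y))
    (by intros; simp only [map_add, add_apply])
    (by intros; simp only [map_smul, smul_apply])
    (by intros; simp only [map_add])
    (by intros; simp only [map_smul]))
  have h1 : B P P = ∑ i, ∑ j, P i * P j * B (EuclideanSpace.single i 1)
      (EuclideanSpace.single j 1) := by
    conv_lhs => rw [map_eq_sum_single B P]
    simp only [LinearMap.sum_apply, LinearMap.smul_apply]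
    refine Finset.sum_congr rfl fun i _ => ?_
    rw [map_eq_sum_single (B _) P]
    simp only [Finset.mul_sum, smul_eq_mul, mul_assoc]
  have h2 := sum_graphFrame P B
  rw [h1] at h2
  exact h2

/-- The graph equation in non-divergence form: `u_t = Δu - D²u(Du, Du) / (1 + |Du|²)`. -/
def SolvesGraphEquation (f : EuclideanSpace ℝ (Fin n) × ℝ → ℝ)
    (Ω : Set (EuclideanSpace ℝ (Fin n) × ℝ)) : Prop :=
  ∀ z ∈ Ω, dirDeriv timeDir f z = ∑ k, dirDeriv (spaceDir k) (dirDeriv (spaceDir k) f) z -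
    (1 + ‖spaceGrad f z‖ ^ 2)⁻¹ * ∑ i, ∑ j, dirDeriv (spaceDir i) f z * dirDeriv (spaceDir j) f z *
      dirDeriv (spaceDir i) (dirDeriv (spaceDir j) f) z

/-- The heat operator of the graph of `f` at `z`. -/
noncomputable def graphHeatOp (f g : EuclideanSpace ℝ (Fin n) × ℝ → ℝ)
    (z : EuclideanSpace ℝ (Fin n) × ℝ) : ℝ :=
  heatOp timeDir (fun k => (graphFrame (spaceGrad f z) k, (0 : ℝ))) g z

theorem graphHeatOp_self {f : EuclideanSpace ℝ (Fin n) × ℝ → ℝ}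
    {Ω : Set (EuclideanSpace ℝ (Fin n) × ℝ)} (hΩ : IsOpen Ω) (hf : ContDiffOn ℝ ∞ f Ω)
    (hs : SolvesGraphEquation f Ω) {z : EuclideanSpace ℝ (Fin n) × ℝ} (hz : z ∈ Ω) :
    graphHeatOp f f z = 0 := by
  rw [graphHeatOp, heatOp, sum_dirDeriv_graphFrame_sq hΩ hf hz, hs z hz]
  simp [spaceGrad]

theorem norm_spaceGrad_sq (f : EuclideanSpace ℝ (Fin n) × ℝ → ℝ)
    (z : EuclideanSpace ℝ (Fin n) × ℝ) :
    ‖spaceGrad f z‖ ^ 2 = ∑ i, dirDeriv (spaceDir i) f z ^ 2 := by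
  rw [EuclideanSpace.real_norm_sq_eq]; simp [spaceGrad]

/-- Differentiate the equation in the direction `c`. The derivatives falling on the coefficients
combine into a multiple of the squared tangential gradient of `∂_c f`, because the gradient of `f`
at `z` is parallel to `c`. -/
theorem graphHeatOp_dirDeriv {f : EuclideanSpace ℝ (Fin n) × ℝ → ℝ}
    {Ω : Set (EuclideanSpace ℝ (Fin n) × ℝ)} (hΩ : IsOpen Ω) (hf : ContDiffOn ℝ ∞ f Ω)
    (hs : SolvesGraphEquation f Ω) {z : EuclideanSpace ℝ (Fin n) × ℝ} (hz : z ∈ Ω)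
    {c : EuclideanSpace ℝ (Fin n)} {p : ℝ} (hp : spaceGrad f z = p • c) (hc : ‖c‖ = 1) :
    graphHeatOp f (dirDeriv (c, (0 : ℝ)) f) z =
      -(2 * p / (1 + p ^ 2)) * ∑ k, dirDeriv (graphFrame (spaceGrad f z) k, (0 : ℝ))
        (dirDeriv (c, (0 : ℝ)) f) z ^ 2 := by
  set w := dirDeriv (c, (0 : ℝ)) f with hw
  have hws : ContDiffOn ℝ ∞ w Ω := hf.contDiffOn_dirDeriv hΩ _
  have hP : ‖spaceGrad f z‖ ^ 2 = p ^ 2 := by rw [hp, norm_smul, hc]; simp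
  -- Clearing the denominator makes the equation polynomial in the derivatives of `f`.
  have hpde : ∀ y ∈ Ω, (1 + ∑ i, dirDeriv (spaceDir i) f y ^ 2) * (dirDeriv timeDir f y -
      ∑ k, dirDeriv (spaceDir k) (dirDeriv (spaceDir k) f) y) +
      ∑ i, ∑ j, dirDeriv (spaceDir i) f y * dirDeriv (spaceDir j) f y *
      dirDeriv (spaceDir i) (dirDeriv (spaceDir j) f) y = 0 := by
    intro y hy
    rw [hs y hy, norm_spaceGrad_sq]
    have : 0 < 1 + ∑ i, dirDeriv (spaceDir i) f y ^ 2 := by positivity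
    field_simp
    ring
  have hD : ∀ {g}, ContDiffOn ℝ ∞ g Ω → ∀ {a}, HasDerivAt
      (fun s : ℝ => g (z + s • a)) (dirDeriv a g z) 0 :=
    fun hg => hg.hasDerivAt_dirDeriv hΩ hz _
  have hfi : ∀ a, ContDiffOn ℝ ∞ (dirDeriv a f) Ω := hf.contDiffOn_dirDeriv hΩ
  have hfij : ∀ a b, ContDiffOn ℝ ∞ (dirDeriv a (dirDeriv b f)) Ω := fun a b =>
    (hfi b).contDiffOn_dirDeriv hΩ a
  have hcomm : ∀ a, dirDeriv (c, (0 : ℝ)) (dirDeriv a f) z = dirDeriv a w z :=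
    fun a => dirDeriv_comm hΩ hf hz _ _
  have hcomm2 : ∀ a b, dirDeriv (c, (0 : ℝ)) (dirDeriv a (dirDeriv b f)) z =
      dirDeriv a (dirDeriv b w) z := by
    intro a b
    rw [dirDeriv_comm hΩ (hfi b) hz]
    exact dirDeriv_congr hΩ (fun y hy => dirDeriv_comm hΩ hf hy _ _) hz _
  have hder := (((HasDerivAt.fun_sum (u := Finset.univ) fun i (_ : i ∈ Finset.univ) =>
      (hD (hfi (spaceDir i)) (a := (c, (0 : ℝ)))).fun_pow 2).const_add 1).mul
    ((hD (hfi timeDir) (a := (c, (0 : ℝ)))).sub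
      (HasDerivAt.fun_sum (u := Finset.univ) fun i (_ : i ∈ Finset.univ) =>
        (hD (hfij (spaceDir i) (spaceDir i)) (a := (c, (0 : ℝ))))))).add
    (HasDerivAt.fun_sum (u := Finset.univ) fun i (_ : i ∈ Finset.univ) =>
      HasDerivAt.fun_sum (u := Finset.univ) fun j (_ : j ∈ Finset.univ) =>
        ((hD (hfi (spaceDir i)) (a := (c, (0 : ℝ)))).mul
        (hD (hfi (spaceDir j)) (a := (c, (0 : ℝ))))).mul
          (hD (hfij (spaceDir i) (spaceDir j)) (a := (c, (0 : ℝ)))))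
  have hzero := hder.unique ((hasDerivAt_const (0 : ℝ) (0 : ℝ)).congr_of_eventuallyEq (by
    have hcont : Tendsto (fun s : ℝ => z + s • (c, (0 : ℝ))) (𝓝 0) (𝓝 z) := by
      have := (hasDerivAt_line z (c, (0 : ℝ)) 0).continuousAt.tendsto
      simpa using this
    filter_upwards [hcont.eventually (hΩ.mem_nhds hz)] with s hs
    simpa using hpde _ hs))
  simp only [zero_smul, add_zero, hcomm, hcomm2, Pi.mul_apply, Pi.sub_apply] at hzero
  have hu : ∀ i, dirDeriv (spaceDir i) f z = p * c i := by
    intro i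
    have := congrArg (fun y : EuclideanSpace ℝ (Fin n) => y i) hp
    simpa [spaceGrad] using this
  have hH : ∀ i, ∑ j, c j * dirDeriv (spaceDir i) (dirDeriv (spaceDir j) f) z =
      dirDeriv (spaceDir i) w z := by
    intro i
    rw [← hcomm, dirDeriv_space]
    exact Finset.sum_congr rfl fun j _ => by rw [dirDeriv_comm hΩ hf hz]
  have hH' : ∀ j, ∑ i, c i * dirDeriv (spaceDir i) (dirDeriv (spaceDir j) f) z =
      dirDeriv (spaceDir j) w z := by
    intro j
    rw [← hcomm, dirDeriv_space]
  have hsq := sum_dirDeriv_graphFrame_mul (spaceGrad f z) w w z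
  simp only [← pow_two] at hsq
  rw [graphHeatOp, heatOp, sum_dirDeriv_graphFrame_sq hΩ hws hz, hsq, hP]
  have hpos : 0 < 1 + p ^ 2 := by positivity
  have hT := hs z hz
  rw [hP] at hT
  have hS : ∑ i, dirDeriv (spaceDir i) f z ^ 2 = p ^ 2 := by rw [← norm_spaceGrad_sq, hP]
  set A := ∑ i, c i * dirDeriv (spaceDir i) w z with hA
  have e1 : ∑ i, ∑ j, dirDeriv (spaceDir i) f z * dirDeriv (spaceDir j) f z *
      dirDeriv (spaceDir i) (dirDeriv (spaceDir j) f) z = p ^ 2 * A := by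
    rw [hA, Finset.mul_sum]
    refine Finset.sum_congr rfl fun i _ => ?_
    rw [← hH, Finset.mul_sum, Finset.mul_sum]
    exact Finset.sum_congr rfl fun j _ => by rw [hu, hu]; ring
  have e2 : ∑ i, ∑ j, dirDeriv (spaceDir i) w z * dirDeriv (spaceDir j) f z *
      dirDeriv (spaceDir i) (dirDeriv (spaceDir j) f) z =
      p * ∑ i, dirDeriv (spaceDir i) w z ^ 2 := by
    rw [Finset.mul_sum]
    refine Finset.sum_congr rfl fun i _ => ?_
    rw [pow_two]
    nth_rewrite 3 [← hH]
    rw [Finset.mul_sum, Finset.mul_sum]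
    exact Finset.sum_congr rfl fun j _ => by rw [hu]; ring
  have e3 : ∑ i, ∑ j, dirDeriv (spaceDir i) f z * dirDeriv (spaceDir j) w z *
      dirDeriv (spaceDir i) (dirDeriv (spaceDir j) f) z =
      p * ∑ i, dirDeriv (spaceDir i) w z ^ 2 := by
    rw [Finset.sum_comm, Finset.mul_sum]
    refine Finset.sum_congr rfl fun i _ => ?_
    rw [pow_two]
    nth_rewrite 3 [← hH']
    rw [Finset.mul_sum, Finset.mul_sum]
    exact Finset.sum_congr rfl fun j _ => by rw [hu]; ring
  have e4 : ∑ i, 2 * dirDeriv (spaceDir i) f z * dirDeriv (spaceDir i) w z = 2 * p * A := by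
    rw [hA, Finset.mul_sum]
    exact Finset.sum_congr rfl fun j _ => by rw [hu]; ring
  have e5 : inner ℝ (spaceGrad f z) (spaceGrad w z) = p * A := by
    rw [hp, inner_smul_left, PiLp.inner_apply, hA]
    simp [spaceGrad, mul_comm]
  have e6 : ∑ i, ∑ j, spaceGrad f z i * spaceGrad f z j *
      dirDeriv (spaceDir i) (dirDeriv (spaceDir j) w) z =
      ∑ i, ∑ j, dirDeriv (spaceDir i) f z * dirDeriv (spaceDir j) f z *
      dirDeriv (spaceDir i) (dirDeriv (spaceDir j) w) z := rfl
  rw [e6, e5, real_inner_self_eq_norm_sq, norm_spaceGrad_sq]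
  rw [e1] at hT
  simp only [add_mul, Finset.sum_add_distrib, Nat.cast_ofNat, Nat.add_one_sub_one, pow_one, e2, e3,
    e4, hS, hT] at hzero
  field_simp at hzero ⊢
  linear_combination hzero

end Graph

/-! ### From the divergence form to the space-time equation -/

section Bridge

variable {n : ℕ}

theorem fderiv_slice {f : EuclideanSpace ℝ (Fin n) × ℝ → ℝ} {x : EuclideanSpace ℝ (Fin n)} {t : ℝ}
    (hf : DifferentiableAt ℝ f (x, t)) (a : EuclideanSpace ℝ (Fin n)) :
    fderiv ℝ (fun y => f (y, t)) x a = dirDeriv (a, (0 : ℝ)) f (x, t) := by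
  have h := hf.hasFDerivAt.comp (f := fun y => (y, t)) x (hasFDerivAt_prodMk_left x t)
  have h2 : fderiv ℝ (fun y => f (y, t)) x = _ := h.fderiv
  rw [h2]
  simp [dirDeriv]

theorem gradient_slice {f : EuclideanSpace ℝ (Fin n) × ℝ → ℝ} {x : EuclideanSpace ℝ (Fin n)} {t : ℝ}
    (hf : DifferentiableAt ℝ f (x, t)) :
    gradient (fun y => f (y, t)) x = spaceGrad f (x, t) := by
  refine ext_inner_left ℝ fun a => ?_
  rw [real_inner_comm, inner_gradient_left, fderiv_slice hf, dirDeriv_space_eq_inner]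

theorem deriv_slice {f : EuclideanSpace ℝ (Fin n) × ℝ → ℝ} {x : EuclideanSpace ℝ (Fin n)} {t : ℝ}
    (hf : DifferentiableAt ℝ f (x, t)) :
    deriv (fun s => f (x, s)) t = dirDeriv timeDir f (x, t) := by
  have h := hf.hasFDerivAt.comp_hasDerivAt t ((hasDerivAt_const t x).prodMk (hasDerivAt_id t))
  exact h.deriv

theorem graphMeanCurvatureOp_eq {f : EuclideanSpace ℝ (Fin n) × ℝ → ℝ}
    {Ω : Set (EuclideanSpace ℝ (Fin n) × ℝ)} (hΩ : IsOpen Ω) (hf : ContDiffOn ℝ ∞ f Ω)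
    {x : EuclideanSpace ℝ (Fin n)} {t : ℝ} (hz : (x, t) ∈ Ω) :
    graphMeanCurvatureOp (fun y => f (y, t)) x =
      ∑ k, dirDeriv (spaceDir k) (dirDeriv (spaceDir k) f) (x, t) -
      (1 + ‖spaceGrad f (x, t)‖ ^ 2)⁻¹ * ∑ i, ∑ j,
        dirDeriv (spaceDir i) f (x, t) * dirDeriv (spaceDir j) f (x, t) *
        dirDeriv (spaceDir i) (dirDeriv (spaceDir j) f) (x, t) := by
  have hd : ∀ {y}, y ∈ Ω → DifferentiableAt ℝ f y := fun hy => hf.differentiableAt_of_isOpen hΩ hy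
  have hfi : ∀ a, ContDiffOn ℝ ∞ (dirDeriv a f) Ω := hf.contDiffOn_dirDeriv hΩ
  -- the integrand of the divergence, as a field on space-time
  let G : Fin n → EuclideanSpace ℝ (Fin n) × ℝ → ℝ := fun i y =>
    (√(1 + ∑ j, dirDeriv (spaceDir j) f y ^ 2))⁻¹ * dirDeriv (spaceDir i) f y
  have hGd : ∀ i, ContDiffOn ℝ ∞ (G i) Ω := by
    intro i
    refine ContDiffOn.mul (ContDiffOn.inv (ContDiffOn.sqrt (contDiffOn_const.add
      (ContDiffOn.sum fun j _ => (hfi _).pow 2)) fun y _ => by positivity) fun y _ => ?_) (hfi _)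
    have : 0 < √(1 + ∑ j, dirDeriv (spaceDir j) f y ^ 2) := Real.sqrt_pos.2 (by positivity)
    exact this.ne'
  have hev : (fun y => (√(1 + ‖gradient (fun y => f (y, t)) y‖ ^ 2))⁻¹ •
      gradient (fun y => f (y, t)) y) =ᶠ[𝓝 x] fun y => WithLp.toLp 2 fun i => G i (y, t) := by
    have hc : Tendsto (fun y : EuclideanSpace ℝ (Fin n) => (y, t)) (𝓝 x) (𝓝 (x, t)) :=
      (Continuous.prodMk_left t).tendsto x
    filter_upwards [hc.eventually (hΩ.mem_nhds hz)] with y hy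
    rw [gradient_slice (hd hy), norm_spaceGrad_sq]
    ext i
    simp [G, spaceGrad]
  have hfd : HasFDerivAt (fun y => WithLp.toLp 2 fun i => G i (y, t))
      (fderiv ℝ (fun y => WithLp.toLp 2 fun i => G i (y, t)) x) x := by
    refine DifferentiableAt.hasFDerivAt ?_
    rw [differentiableAt_euclidean]
    intro i
    have := ((hGd i).differentiableAt_of_isOpen hΩ hz).hasFDerivAt.comp (f := fun y => (y, t)) x
      (hasFDerivAt_prodMk_left x t)
    exact this.differentiableAt
  have hcoord : ∀ i, (fderiv ℝ (fun y => WithLp.toLp 2 fun i => G i (y, t)) x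
      (EuclideanSpace.single i 1)) i = dirDeriv (spaceDir i) (G i) (x, t) := by
    intro i
    have h1 := (EuclideanSpace.proj (𝕜 := ℝ) i).hasFDerivAt.comp x hfd
    have h2 := fderiv_slice ((hGd i).differentiableAt_of_isOpen hΩ hz) (EuclideanSpace.single i 1)
    have h3 : fderiv ℝ (fun y => G i (y, t)) x = _ := h1.fderiv
    rw [h3] at h2
    simpa [spaceDir] using h2
  set S := ∑ j, dirDeriv (spaceDir j) f (x, t) ^ 2 with hS
  have hS0 : 0 ≤ S := Finset.sum_nonneg fun _ _ => sq_nonneg _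
  set v := √(1 + S) with hv
  have hv2 : v ^ 2 = 1 + S := Real.sq_sqrt (by positivity)
  have hv0 : 0 < v := Real.sqrt_pos.2 (by positivity)
  have hG' : ∀ i, dirDeriv (spaceDir i) (G i) (x, t) =
      v⁻¹ * dirDeriv (spaceDir i) (dirDeriv (spaceDir i) f) (x, t) -
      v⁻¹ * (v ^ 2)⁻¹ * ∑ j, dirDeriv (spaceDir i) f (x, t) * dirDeriv (spaceDir j) f (x, t) *
        dirDeriv (spaceDir i) (dirDeriv (spaceDir j) f) (x, t) := by
    intro i
    refine dirDeriv_eq_of_hasDerivAt ((hGd i).differentiableAt_of_isOpen hΩ hz) ?_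
    have h1 : ∀ a, HasDerivAt (fun s : ℝ => dirDeriv a f ((x, t) + s • spaceDir i))
        (dirDeriv (spaceDir i) (dirDeriv a f) (x, t)) 0 :=
      fun a => (hfi a).hasDerivAt_dirDeriv hΩ hz (spaceDir i)
    have h2 := (HasDerivAt.fun_sum (u := Finset.univ) fun j (_ : j ∈ Finset.univ) =>
      (h1 (spaceDir j)).fun_pow 2).const_add 1
    have h3 := h2.sqrt (by simp only [zero_smul, add_zero]; rw [← hS]; positivity)
    have hne : √(1 + ∑ j, dirDeriv (spaceDir j) f ((x, t) + (0 : ℝ) • spaceDir i) ^ 2) ≠ 0 := by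
      simp only [zero_smul, add_zero]
      exact hv0.ne'
    have h4 := (h3.fun_inv hne).fun_mul (h1 (spaceDir i))
    refine h4.congr_deriv ?_
    simp only [zero_smul, add_zero, ← hS, ← hv, Nat.cast_ofNat, Nat.add_one_sub_one, pow_one,
      mul_assoc, ← Finset.mul_sum]
    field_simp
    ring
  unfold graphMeanCurvatureOp euclideanDiv
  rw [hev.fderiv_eq, gradient_slice (hd hz), norm_spaceGrad_sq, ← hS, ← hv, ← hv2]
  simp only [hcoord, hG', Finset.sum_sub_distrib, ← Finset.mul_sum]
  field_simp

theorem isOpen_cylinder {U : Set (EuclideanSpace ℝ (Fin n))} (hU : IsOpen U) (T : ℝ) :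
    IsOpen (U ×ˢ Set.Ioo 0 T) := hU.prod isOpen_Ioo

theorem GraphFlowsByMeanCurvature.solvesGraphEquation {U : Set (EuclideanSpace ℝ (Fin n))}
    (hU : IsOpen U) {T : ℝ} {u : EuclideanSpace ℝ (Fin n) → ℝ → ℝ}
    (h : GraphFlowsByMeanCurvature U T u) :
    SolvesGraphEquation (fun z => u z.1 z.2) (U ×ˢ Set.Ioo 0 T) := by
  rintro ⟨x, t⟩ ⟨hx, ht⟩
  have hΩ := isOpen_cylinder hU T
  have hz : (x, t) ∈ U ×ˢ Set.Ioo 0 T := ⟨hx, ht⟩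
  rw [← deriv_slice (h.smooth.differentiableAt_of_isOpen hΩ hz),
    ← graphMeanCurvatureOp_eq hΩ h.smooth hz]
  exact h.equation x hx t ht

end Bridge

/-! ### Maximum principle on cylinders and sphere barriers -/

section Barrier

variable {n : ℕ}

theorem heatOp_nonneg_of_isMaxOn {Ω : Set (EuclideanSpace ℝ (Fin n) × ℝ)} (hΩ : IsOpen Ω)
    {f : EuclideanSpace ℝ (Fin n) × ℝ → ℝ} (hf : ContDiffOn ℝ ∞ f Ω)
    {ρ t₁ t₂ : ℝ} {z : EuclideanSpace ℝ (Fin n) × ℝ} (hz : z ∈ Ω)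
    (hx : ‖z.1‖ < ρ) (ht₁ : t₁ < z.2) (ht₂ : z.2 ≤ t₂)
    (hmax : ∀ᶠ y in 𝓝 z, y ∈ Metric.closedBall (0 : EuclideanSpace ℝ (Fin n)) ρ ×ˢ Set.Icc t₁ t₂ →
      f y ≤ f z)
    {ι : Type*} [Fintype ι] (b : ι → EuclideanSpace ℝ (Fin n)) :
    0 ≤ heatOp timeDir (fun k => (b k, (0 : ℝ))) f z := by
  have hc : ∀ a : EuclideanSpace ℝ (Fin n) × ℝ,
      Tendsto (fun s : ℝ => z + s • a) (𝓝 0) (𝓝 z) := by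
    intro a
    have := (hasDerivAt_line z a 0).continuousAt.tendsto
    simpa using this
  have hnear : ∀ᶠ y in 𝓝 z, ‖y.1‖ < ρ ∧ t₁ < y.2 := by
    have h1 : Continuous fun y : EuclideanSpace ℝ (Fin n) × ℝ => ‖y.1‖ := by fun_prop
    exact (h1.continuousAt.eventually (gt_mem_nhds hx)).and
      (continuous_snd.continuousAt.eventually (lt_mem_nhds ht₁))
  refine heatOp_nonneg_of_parabolic_max hΩ hf hz _ _ ?_ fun k => ?_
  · have h := ((hc timeDir).eventually (hmax.and hnear)).filter_mono
      (nhdsWithin_le_nhds (s := Set.Iio 0))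
    filter_upwards [h, self_mem_nhdsWithin] with s hs hs0
    refine hs.1 ⟨by simpa using hs.2.1.le, hs.2.2.le, ?_⟩
    have : s < 0 := hs0
    simp only [timeDir, Prod.snd_add, Prod.smul_snd, smul_eq_mul, mul_one]
    linarith
  · filter_upwards [(hc (b k, 0)).eventually (hmax.and hnear)] with s hs
    exact hs.1 ⟨by simpa using hs.2.1.le, hs.2.2.le, by simpa using ht₂⟩

theorem contDiff_normSq_fst : ContDiff ℝ ∞ fun z : EuclideanSpace ℝ (Fin n) × ℝ => ‖z.1‖ ^ 2 :=
  contDiff_fst.norm_sq ℝ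

theorem dirDeriv_normSq (a z : EuclideanSpace ℝ (Fin n) × ℝ) :
    dirDeriv a (fun z : EuclideanSpace ℝ (Fin n) × ℝ => ‖z.1‖ ^ 2) z = 2 * inner ℝ z.1 a.1 := by
  have h := (hasFDerivAt_fst (𝕜 := ℝ) (p := z)).norm_sq
  unfold dirDeriv
  rw [h.fderiv]
  simp

theorem dirDeriv_dirDeriv_normSq (a z : EuclideanSpace ℝ (Fin n) × ℝ) :
    dirDeriv a (dirDeriv a (fun z : EuclideanSpace ℝ (Fin n) × ℝ => ‖z.1‖ ^ 2)) z =
      2 * ‖a.1‖ ^ 2 := by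
  have h : dirDeriv a (fun z : EuclideanSpace ℝ (Fin n) × ℝ => ‖z.1‖ ^ 2) =
      fun z => 2 * inner ℝ z.1 a.1 := funext fun z => dirDeriv_normSq a z
  have h2 := ((hasFDerivAt_fst (𝕜 := ℝ) (p := z)).inner ℝ (hasFDerivAt_const a.1 z)).const_mul 2
  rw [h]
  unfold dirDeriv
  rw [h2.fderiv]
  simp

theorem sum_normSq_graphFrame (P : EuclideanSpace ℝ (Fin n)) :
    ∑ k, ‖graphFrame P k‖ ^ 2 = n - ‖P‖ ^ 2 / (1 + ‖P‖ ^ 2) := by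
  have := sum_graphFrame P (innerₗ (EuclideanSpace ℝ (Fin n)))
  simp only [innerₗ_apply_apply, real_inner_self_eq_norm_sq] at this
  rw [this]
  simp [div_eq_inv_mul]

theorem graphHeatOp_normSq (f : EuclideanSpace ℝ (Fin n) × ℝ → ℝ)
    (z : EuclideanSpace ℝ (Fin n) × ℝ) :
    graphHeatOp f (fun z : EuclideanSpace ℝ (Fin n) × ℝ => ‖z.1‖ ^ 2) z =
      -(2 * (n - ‖spaceGrad f z‖ ^ 2 / (1 + ‖spaceGrad f z‖ ^ 2))) := by
  simp only [graphHeatOp, heatOp, dirDeriv_dirDeriv_normSq, ← Finset.mul_sum,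
    sum_normSq_graphFrame]
  simp [dirDeriv_normSq, timeDir]

theorem heatOp_time (z : EuclideanSpace ℝ (Fin n) × ℝ) {ι : Type*} [Fintype ι]
    (b : ι → EuclideanSpace ℝ (Fin n)) :
    heatOp timeDir (fun k => (b k, (0 : ℝ))) (fun z => z.2) z = 1 := by
  have : ∀ a, dirDeriv a (fun z : EuclideanSpace ℝ (Fin n) × ℝ => z.2) = fun _ => a.2 := by
    intro a; ext y; simp [dirDeriv, fderiv_snd]
  simp only [heatOp, this]
  simp [timeDir, dirDeriv]

theorem sum_dirDeriv_graphFrame_self (f : EuclideanSpace ℝ (Fin n) × ℝ → ℝ)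
    (z : EuclideanSpace ℝ (Fin n) × ℝ) :
    ∑ k, dirDeriv (graphFrame (spaceGrad f z) k, (0 : ℝ)) f z ^ 2 =
      ‖spaceGrad f z‖ ^ 2 / (1 + ‖spaceGrad f z‖ ^ 2) := by
  have h := sum_dirDeriv_graphFrame_mul (spaceGrad f z) f f z
  simp only [← pow_two] at h
  rw [h, real_inner_self_eq_norm_sq]
  have : 0 < 1 + ‖spaceGrad f z‖ ^ 2 := by positivity
  field_simp
  ring

/-- The squared distance from a point, corrected by `2nt`, is caloric on a graph flowing by mean
curvature. -/
theorem graphHeatOp_sphere {f : EuclideanSpace ℝ (Fin n) × ℝ → ℝ}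
    {Ω : Set (EuclideanSpace ℝ (Fin n) × ℝ)} (hΩ : IsOpen Ω) (hf : ContDiffOn ℝ ∞ f Ω)
    (hs : SolvesGraphEquation f Ω) {z : EuclideanSpace ℝ (Fin n) × ℝ} (hz : z ∈ Ω) (h c : ℝ) :
    graphHeatOp f (fun z => ‖z.1‖ ^ 2 + (f z - h) ^ 2 + c * z.2) z = c - 2 * n := by
  have h1 := graphHeatOp_normSq f z
  have h2 := graphHeatOp_self hΩ hf hs hz
  unfold graphHeatOp at h1 h2 ⊢
  have hsq : ContDiffOn ℝ ∞ (fun z => (f z - h) ^ 2) Ω := (hf.sub contDiffOn_const).pow 2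
  have htime : ContDiffOn ℝ ∞ (fun z : EuclideanSpace ℝ (Fin n) × ℝ => z.2) Ω :=
    contDiff_snd.contDiffOn
  rw [heatOp_add hΩ (f := fun z => ‖z.1‖ ^ 2 + (f z - h) ^ 2)
      (contDiff_normSq_fst.contDiffOn.add hsq) (contDiffOn_const.mul htime) hz,
    heatOp_add hΩ contDiff_normSq_fst.contDiffOn hsq hz, heatOp_const_mul hΩ htime hz, heatOp_time,
    h1, heatOp_comp hΩ hf (g := fun s => (s - h) ^ 2) (g' := fun s => 2 * (s - h)) (g'' := 2) hz
      (fun s => by simpa using ((hasDerivAt_id s).sub_const h).fun_pow 2)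
      (by simpa using ((hasDerivAt_id (f z)).sub_const h).const_mul 2), h2,
    sum_dirDeriv_graphFrame_self]
  ring

theorem sphere_barrier {R R₀ T T' h : ℝ} {u : EuclideanSpace ℝ (Fin n) → ℝ → ℝ}
    (hu : GraphFlowsByMeanCurvature (Metric.ball 0 R) T u) (hR : R₀ < R) (hT : T' < T)
    (hinit : ∀ x ∈ Metric.ball 0 R, R₀ ^ 2 ≤ (u x 0 - h) ^ 2)
    {x : EuclideanSpace ℝ (Fin n)} {t : ℝ} (hx : ‖x‖ ≤ R₀) (ht : t ∈ Set.Icc 0 T') :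
    R₀ ^ 2 ≤ ‖x‖ ^ 2 + (u x t - h) ^ 2 + 2 * n * t := by
  set Q := Metric.closedBall (0 : EuclideanSpace ℝ (Fin n)) R₀ ×ˢ Set.Icc 0 T' with hQ
  have hQc : IsCompact Q := (isCompact_closedBall _ _).prod isCompact_Icc
  have hQsub : Q ⊆ Metric.ball 0 R ×ˢ Set.Icc 0 T :=
    Set.prod_mono (Metric.closedBall_subset_ball hR) (Set.Icc_subset_Icc_right hT.le)
  have hxt : (x, t) ∈ Q := ⟨by simpa using hx, ht⟩
  have hΩ := isOpen_cylinder (Metric.isOpen_ball (x := (0 : EuclideanSpace ℝ (Fin n))) (ε := R)) T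
  -- The extra `ε t` gives the function heat operator `ε > 0`, which excludes an interior minimum;
  -- `ε` tends to 0 at the end.
  have key : ∀ ε > 0, R₀ ^ 2 ≤ ‖x‖ ^ 2 + (u x t - h) ^ 2 + (2 * n + ε) * t := by
    intro ε hε
    set F : EuclideanSpace ℝ (Fin n) × ℝ → ℝ :=
      fun z => ‖z.1‖ ^ 2 + (u z.1 z.2 - h) ^ 2 + (2 * n + ε) * z.2 with hF
    have hFc : ContinuousOn F Q := by
      have h1 := hu.continuousOn.mono hQsub
      have h2 : Continuous fun z : EuclideanSpace ℝ (Fin n) × ℝ => ‖z.1‖ ^ 2 := by fun_prop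
      exact (h2.continuousOn.add ((h1.sub continuousOn_const).pow 2)).add
        (continuous_const.mul continuous_snd).continuousOn
    obtain ⟨z, hzQ, hmin⟩ := hQc.exists_isMinOn ⟨_, hxt⟩ hFc
    have hmin' : ∀ y ∈ Q, F z ≤ F y := fun y hy => hmin hy
    have hFxt : F (x, t) = ‖x‖ ^ 2 + (u x t - h) ^ 2 + (2 * n + ε) * t := by simp only [hF]
    rw [← hFxt]
    suffices hFz : R₀ ^ 2 ≤ F z from hFz.trans (hmin' _ hxt)
    have hz1 : ‖z.1‖ ≤ R₀ := by simpa using hzQ.1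
    have hz2 := hzQ.2
    have hR0 : 0 ≤ R₀ := (norm_nonneg _).trans hz1
    have hn2 : 0 ≤ (2 * n + ε) * z.2 := mul_nonneg (by positivity) hz2.1
    -- On the lateral boundary `‖x‖² = R₀²` already suffices, so nothing about `u` is needed there.
    rcases hz1.eq_or_lt with heq | hlt
    · simp only [hF]
      rw [heq]
      nlinarith [sq_nonneg (u z.1 z.2 - h)]
    rcases hz2.1.eq_or_lt with heq | hpos
    · simp only [hF]
      rw [← heq]
      have := hinit z.1 (Metric.closedBall_subset_ball hR hzQ.1)
      nlinarith [sq_nonneg ‖z.1‖]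
    exfalso
    have hzΩ : z ∈ Metric.ball (0 : EuclideanSpace ℝ (Fin n)) R ×ˢ Set.Ioo 0 T :=
      ⟨Metric.closedBall_subset_ball hR hzQ.1, hpos, hz2.2.trans_lt hT⟩
    have hFs : ContDiffOn ℝ ∞ F (Metric.ball 0 R ×ˢ Set.Ioo 0 T) :=
      (contDiff_normSq_fst.contDiffOn.add ((hu.smooth.sub contDiffOn_const).pow 2)).add
        (contDiffOn_const.mul contDiff_snd.contDiffOn)
    have h1 := graphHeatOp_sphere hΩ hu.smooth
      (hu.solvesGraphEquation Metric.isOpen_ball) hzΩ h (2 * n + ε)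
    have h2 := heatOp_nonneg_of_isMaxOn hΩ (f := fun y => -1 * F y)
      (contDiffOn_const.mul hFs) hzΩ hlt hpos hz2.2
      (Eventually.of_forall fun y hy => by linarith [hmin' y hy])
      (graphFrame (spaceGrad (fun z => u z.1 z.2) z))
    rw [heatOp_const_mul hΩ hFs hzΩ] at h2
    unfold graphHeatOp at h1
    linarith
  refine le_of_forall_pos_le_add fun δ hδ => ?_
  have hpos : 0 < 1 + t := by linarith [ht.1]
  have := key (δ / (1 + t)) (by positivity)
  have h2 : δ / (1 + t) * t ≤ δ := by
    rw [div_mul_eq_mul_div, div_le_iff₀ hpos]; nlinarith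
  linarith

/-- Take spheres centred at heights `±(M + R₀)`. If the graph reached a centre height over `‖x‖ ≤
ρ`, the barrier would give `R₀² ≤ ρ² + 2nT'`. By continuity in time the graph never crosses these
heights. -/
theorem abs_lt_of_sphere_barriers {R R₀ T T' M ρ : ℝ} {u : EuclideanSpace ℝ (Fin n) → ℝ → ℝ}
    (hu : GraphFlowsByMeanCurvature (Metric.ball 0 R) T u) (hR0 : 0 < R₀) (hR : R₀ < R)
    (hT : T' < T) (hinit : ∀ x ∈ Metric.ball 0 R, |u x 0| ≤ M)
    (hρR : ρ ^ 2 + 2 * n * T' < R₀ ^ 2)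
    {x : EuclideanSpace ℝ (Fin n)} {t : ℝ} (hx : ‖x‖ ≤ ρ) (ht : t ∈ Set.Icc 0 T') :
    |u x t| < M + R₀ := by
  have hT0 : 0 ≤ T' := ht.1.trans ht.2
  have hxρ : ‖x‖ ^ 2 ≤ ρ ^ 2 := by gcongr
  have hxR : ‖x‖ ≤ R₀ := by
    refine abs_le_of_sq_le_sq' ?_ hR0.le |>.2
    have : 0 ≤ 2 * n * T' := by positivity
    linarith
  have hxB : x ∈ Metric.ball (0 : EuclideanSpace ℝ (Fin n)) R := by
    simpa using hxR.trans_lt hR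
  have hcont : ContinuousOn (fun s => u x s) (Set.Icc 0 t) := by
    have : ContinuousOn (fun s : ℝ => (x, s)) (Set.Icc 0 t) := by fun_prop
    exact hu.continuousOn.comp this fun s hs =>
      ⟨hxB, hs.1, (hs.2.trans ht.2).trans hT.le⟩
  have hne : ∀ h, (∀ y ∈ Metric.ball (0 : EuclideanSpace ℝ (Fin n)) R,
      R₀ ^ 2 ≤ (u y 0 - h) ^ 2) → ∀ s ∈ Set.Icc 0 t, u x s ≠ h := by
    intro h hh s hs heq
    have h1 := sphere_barrier hu hR hT hh hxR ⟨hs.1, hs.2.trans ht.2⟩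
    have h2 : 2 * n * s ≤ 2 * n * T' := by
      have := hs.2.trans ht.2
      gcongr
    rw [heq] at h1
    nlinarith
  have hpre := isPreconnected_Icc (a := (0 : ℝ)) (b := t)
  have h0 : (0 : ℝ) ∈ Set.Icc 0 t := ⟨le_rfl, ht.1⟩
  have h1 : t ∈ Set.Icc 0 t := ⟨ht.1, le_rfl⟩
  have hx0 := abs_le.1 (hinit x hxB)
  refine abs_lt.2 ⟨?_, ?_⟩
  · by_contra! hcon
    obtain ⟨s, hs, hs2⟩ := hpre.intermediate_value h1 h0 hcont
      (show -(M + R₀) ∈ Set.Icc (u x t) (u x 0) from ⟨hcon, by linarith [hx0.1]⟩)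
    refine hne (-(M + R₀)) (fun y hy => ?_) s hs hs2
    have := (abs_le.1 (hinit y hy)).1
    exact pow_le_pow_left₀ hR0.le (by linarith) 2
  · by_contra! hcon
    obtain ⟨s, hs, hs2⟩ := hpre.intermediate_value h0 h1 hcont
      (show M + R₀ ∈ Set.Icc (u x 0) (u x t) from ⟨by linarith [hx0.2], hcon⟩)
    refine hne (M + R₀) (fun y hy => ?_) s hs hs2
    have := (abs_le.1 (hinit y hy)).2
    rw [← neg_sq (u y 0 - _)]
    exact pow_le_pow_left₀ hR0.le (by linarith) 2

end Barrier

/-! ### The localized gradient estimate -/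

section GradientEstimate

variable {n : ℕ}

theorem hasDerivAt_inv_sqrt_one_add_sq (s : ℝ) :
    HasDerivAt (fun s : ℝ => (√(1 + s ^ 2))⁻¹) (-s * (√(1 + s ^ 2))⁻¹ ^ 3) s := by
  have h0 : 0 < 1 + s ^ 2 := by positivity
  have hv : 0 < √(1 + s ^ 2) := Real.sqrt_pos.2 h0
  have h := ((((hasDerivAt_id s).fun_pow 2).const_add 1).sqrt h0.ne').fun_inv hv.ne'
  refine h.congr_deriv ?_
  simp only [id_eq]
  field_simp
  simp

theorem hasDerivAt_deriv_inv_sqrt_one_add_sq (s : ℝ) :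
    HasDerivAt (fun s : ℝ => -s * (√(1 + s ^ 2))⁻¹ ^ 3)
      (-(√(1 + s ^ 2))⁻¹ ^ 3 + 3 * s ^ 2 * (√(1 + s ^ 2))⁻¹ ^ 5) s := by
  have h := (hasDerivAt_id s).fun_neg.fun_mul ((hasDerivAt_inv_sqrt_one_add_sq s).fun_pow 3)
  refine h.congr_deriv ?_
  simp
  ring

theorem contDiff_inv_sqrt_one_add_sq : ContDiff ℝ ∞ fun s : ℝ => (√(1 + s ^ 2))⁻¹ := by
  refine ContDiff.inv (ContDiff.sqrt (by fun_prop) fun s => by positivity) fun s => ?_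
  exact (Real.sqrt_pos.2 (by positivity)).ne'

/-- Along a graph flowing by mean curvature, `(1 + (∂_c f)²)^{-1/2}` is a supersolution of the heat
equation at points where the gradient is parallel to `c`. -/
theorem graphHeatOp_inv_sqrt_nonneg {f : EuclideanSpace ℝ (Fin n) × ℝ → ℝ}
    {Ω : Set (EuclideanSpace ℝ (Fin n) × ℝ)} (hΩ : IsOpen Ω) (hf : ContDiffOn ℝ ∞ f Ω)
    (hs : SolvesGraphEquation f Ω) {z : EuclideanSpace ℝ (Fin n) × ℝ} (hz : z ∈ Ω)
    {c : EuclideanSpace ℝ (Fin n)} {p : ℝ} (hp : spaceGrad f z = p • c) (hc : ‖c‖ = 1) :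
    0 ≤ graphHeatOp f (fun y => (√(1 + dirDeriv (c, (0 : ℝ)) f y ^ 2))⁻¹) z := by
  have h1 := graphHeatOp_dirDeriv hΩ hf hs hz hp hc
  have hw : dirDeriv (c, (0 : ℝ)) f z = p := by
    rw [dirDeriv_space_eq_inner, hp, inner_smul_right, real_inner_self_eq_norm_sq, hc]; simp
  unfold graphHeatOp at h1 ⊢
  rw [heatOp_comp hΩ (hf.contDiffOn_dirDeriv hΩ (c, (0 : ℝ))) hz hasDerivAt_inv_sqrt_one_add_sq
    (hasDerivAt_deriv_inv_sqrt_one_add_sq _), h1, hw]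
  set A := ∑ k, dirDeriv (graphFrame (spaceGrad f z) k, (0 : ℝ)) (dirDeriv (c, (0 : ℝ)) f) z ^ 2
  have hA : 0 ≤ A := Finset.sum_nonneg fun _ _ => sq_nonneg _
  set q := (√(1 + p ^ 2))⁻¹ with hq
  have hv : 0 < √(1 + p ^ 2) := Real.sqrt_pos.2 (by positivity)
  have hq0 : 0 < q := inv_pos.2 hv
  have hq2 : q ^ 2 * (1 + p ^ 2) = 1 := by
    rw [hq, inv_pow, Real.sq_sqrt (by positivity)]; field_simp
  have hdiv : 2 * p / (1 + p ^ 2) = 2 * p * q ^ 2 := by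
    rw [div_eq_iff (by positivity)]; linear_combination -(2 * p) * hq2
  rw [hdiv]
  -- The coefficients of `A` sum to `2p²q⁵ + q³ - 3p²q⁵ = q³ - p²q⁵`, which is `q⁵` since `q²(1 +
  -- p²) = 1`.
  have : 0 ≤ q ^ 5 * A := by positivity
  refine this.trans_eq ?_
  linear_combination (q ^ 3 * A) * hq2

/-- The function `A t - B |x|² - c f + d` that localizes the gradient estimate. -/
noncomputable def localizer (f : EuclideanSpace ℝ (Fin n) × ℝ → ℝ) (A B c d : ℝ)
    (z : EuclideanSpace ℝ (Fin n) × ℝ) : ℝ :=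
  A * z.2 + -B * ‖z.1‖ ^ 2 + -c * f z + d

theorem contDiffOn_localizer {f : EuclideanSpace ℝ (Fin n) × ℝ → ℝ}
    {Ω : Set (EuclideanSpace ℝ (Fin n) × ℝ)} (hf : ContDiffOn ℝ ∞ f Ω) (A B c d : ℝ) :
    ContDiffOn ℝ ∞ (localizer f A B c d) Ω :=
  (((contDiffOn_const.mul contDiff_snd.contDiffOn).add
    (contDiffOn_const.mul contDiff_normSq_fst.contDiffOn)).add (contDiffOn_const.mul hf)).add
    contDiffOn_const

theorem graphHeatOp_localizer {f : EuclideanSpace ℝ (Fin n) × ℝ → ℝ}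
    {Ω : Set (EuclideanSpace ℝ (Fin n) × ℝ)} (hΩ : IsOpen Ω) (hf : ContDiffOn ℝ ∞ f Ω)
    (hs : SolvesGraphEquation f Ω) {z : EuclideanSpace ℝ (Fin n) × ℝ} (hz : z ∈ Ω)
    (A B c d : ℝ) :
    graphHeatOp f (localizer f A B c d) z =
      A + B * (2 * (n - ‖spaceGrad f z‖ ^ 2 / (1 + ‖spaceGrad f z‖ ^ 2))) := by
  have h1 := graphHeatOp_normSq f z
  have h2 := graphHeatOp_self hΩ hf hs hz
  have hn := (contDiff_normSq_fst (n := n)).contDiffOn (s := Ω)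
  have ht : ContDiffOn ℝ ∞ (fun z : EuclideanSpace ℝ (Fin n) × ℝ => z.2) Ω :=
    contDiff_snd.contDiffOn
  unfold graphHeatOp at h1 h2 ⊢
  unfold localizer
  rw [heatOp_add_const, heatOp_add hΩ (f := fun z => A * z.2 + -B * ‖z.1‖ ^ 2)
    ((contDiffOn_const.mul ht).add (contDiffOn_const.mul hn)) (contDiffOn_const.mul hf) hz,
    heatOp_add hΩ (contDiffOn_const.mul ht) (contDiffOn_const.mul hn) hz,
    heatOp_const_mul hΩ ht hz, heatOp_const_mul hΩ hn hz, heatOp_const_mul hΩ hf hz, heatOp_time,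
    h1, h2]
  ring

theorem spaceGrad_localizer {f : EuclideanSpace ℝ (Fin n) × ℝ → ℝ}
    {z : EuclideanSpace ℝ (Fin n) × ℝ} (hf : DifferentiableAt ℝ f z) (A B c d : ℝ) :
    spaceGrad (localizer f A B c d) z = -((2 * B) • z.1 + c • spaceGrad f z) := by
  ext i
  have hn : DifferentiableAt ℝ (fun z : EuclideanSpace ℝ (Fin n) × ℝ => ‖z.1‖ ^ 2) z :=
    contDiff_normSq_fst.contDiffAt.differentiableAt (by simp)
  have ht : DifferentiableAt ℝ (fun z : EuclideanSpace ℝ (Fin n) × ℝ => z.2) z :=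
    differentiableAt_snd
  have hi : dirDeriv (spaceDir i) (localizer f A B c d) z =
      -B * dirDeriv (spaceDir i) (fun z => ‖z.1‖ ^ 2) z + -c * dirDeriv (spaceDir i) f z := by
    unfold localizer
    rw [dirDeriv_add (((ht.const_mul A).fun_add (hn.const_mul (-B))).fun_add (hf.const_mul (-c)))
      (differentiableAt_const d), dirDeriv_add ((ht.const_mul A).fun_add (hn.const_mul (-B)))
      (hf.const_mul (-c)), dirDeriv_add (ht.const_mul A) (hn.const_mul (-B)),
      dirDeriv_const_mul ht, dirDeriv_const_mul hn, dirDeriv_const_mul hf]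
    simp [dirDeriv, spaceDir, fderiv_snd]
  change dirDeriv (spaceDir i) _ z = -(2 * B * z.1 i + c * dirDeriv (spaceDir i) f z)
  rw [hi, dirDeriv_normSq, spaceDir, EuclideanSpace.inner_single_right]
  simp
  ring

/-- The squared tangential gradient splits into three terms. The one in `B²` is nonnegative by
Cauchy–Schwarz, the cross term is at least `-c²/4` by the bound `16/(ρc)`, and the one in `c²` is at
least `3c²/4` since `v ≥ 2`. -/
theorem sum_dirDeriv_localizer_ge {f : EuclideanSpace ℝ (Fin n) × ℝ → ℝ}
    {z : EuclideanSpace ℝ (Fin n) × ℝ} (hf : DifferentiableAt ℝ f z) {A B c d ρ : ℝ}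
    (hB : B = (ρ ^ 2)⁻¹) (hc : 0 < c) (hρ : 0 < ρ) (hz : ‖z.1‖ ≤ ρ)
    (h2 : 2 ≤ √(1 + ‖spaceGrad f z‖ ^ 2))
    (h16 : 16 / (ρ * c) ≤ √(1 + ‖spaceGrad f z‖ ^ 2)) :
    c ^ 2 / 2 ≤ ∑ k, dirDeriv (graphFrame (spaceGrad f z) k, (0 : ℝ)) (localizer f A B c d) z ^ 2 := by
  have h := sum_dirDeriv_graphFrame_mul (spaceGrad f z) (localizer f A B c d)
    (localizer f A B c d) z
  simp only [← pow_two] at h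
  rw [h, spaceGrad_localizer hf]
  set P := spaceGrad f z
  set x := z.1
  set v := √(1 + ‖P‖ ^ 2) with hv
  have hv2 : v ^ 2 = 1 + ‖P‖ ^ 2 := Real.sq_sqrt (by positivity)
  have hv0 : 0 < v := by linarith
  rw [← hv2]
  simp only [inner_neg_left, inner_neg_right, neg_sq, inner_add_left, inner_add_right,
    inner_smul_left, inner_smul_right, real_inner_self_eq_norm_sq, RCLike.conj_to_real,
    real_inner_comm x P]
  have hP : ‖P‖ ^ 2 = v ^ 2 - 1 := by linarith
  have hxP := abs_real_inner_le_norm x P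
  set y := inner ℝ x P
  have hPv : ‖P‖ ≤ v := by
    rw [hv]; exact Real.le_sqrt_of_sq_le (by linarith)
  have hy : |y| ≤ ρ * v := hxP.trans (by gcongr)
  have hy2 : y ^ 2 ≤ v ^ 2 * ‖x‖ ^ 2 := by
    rw [← sq_abs]
    calc |y| ^ 2 ≤ (‖x‖ * v) ^ 2 := by gcongr; exact hxP.trans (by gcongr)
      _ = _ := by ring
  have e : 2 * B * (2 * B * ‖x‖ ^ 2) + c * (2 * B * y) + (2 * B * (c * y) + c * (c * ‖P‖ ^ 2)) -
      (v ^ 2)⁻¹ * (2 * B * y + c * ‖P‖ ^ 2) ^ 2 =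
      4 * B ^ 2 * (v ^ 2)⁻¹ * (v ^ 2 * ‖x‖ ^ 2 - y ^ 2) + 4 * B * c * (y * (v ^ 2)⁻¹) +
      c ^ 2 * (1 - (v ^ 2)⁻¹) := by
    rw [hP]; field_simp; ring
  have hB0 : 0 < B := by rw [hB]; positivity
  have h3 : 0 ≤ 4 * B ^ 2 * (v ^ 2)⁻¹ * (v ^ 2 * ‖x‖ ^ 2 - y ^ 2) :=
    mul_nonneg (by positivity) (by linarith)
  have h4 : (v ^ 2)⁻¹ ≤ 1 / 4 := by
    rw [inv_le_comm₀ (by positivity) (by norm_num)]; nlinarith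
  have h5 : -(c ^ 2 / 4) ≤ 4 * B * c * (y * (v ^ 2)⁻¹) := by
    have hyv : -(ρ / v) ≤ y * (v ^ 2)⁻¹ := by
      rw [← div_eq_mul_inv, neg_div', div_le_div_iff₀ hv0 (by positivity)]
      nlinarith [neg_le_of_abs_le hy]
    have h6 : 4 * B * c * (ρ / v) ≤ c ^ 2 / 4 := by
      rw [div_le_iff₀ (by positivity)] at h16
      rw [hB]
      have : 4 * (ρ ^ 2)⁻¹ * c * (ρ / v) = 4 * c / (ρ * v) := by field_simp
      rw [this, div_le_div_iff₀ (by positivity) (by norm_num)]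
      nlinarith
    have h7 : 0 < 4 * B * c := by positivity
    nlinarith [mul_le_mul_of_nonneg_left hyv h7.le]
  have h8 : c ^ 2 * (v ^ 2)⁻¹ ≤ c ^ 2 * (1 / 4) := by gcongr
  refine le_of_le_of_eq (b := 4 * B ^ 2 * (v ^ 2)⁻¹ * (v ^ 2 * ‖x‖ ^ 2 - y ^ 2) +
    4 * B * c * (y * (v ^ 2)⁻¹) + c ^ 2 * (1 - (v ^ 2)⁻¹)) (by linarith) ?_
  rw [← e]
  ring

/-- At a parabolic maximum of `(e^{K φ} - 1) √(1 + |Df|²)`, where `φ` is a localizer, the gradient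
is bounded. -/
theorem gradient_bound_of_isMaxOn {f : EuclideanSpace ℝ (Fin n) × ℝ → ℝ}
    {Ω : Set (EuclideanSpace ℝ (Fin n) × ℝ)} (hΩ : IsOpen Ω) (hf : ContDiffOn ℝ ∞ f Ω)
    (hs : SolvesGraphEquation f Ω) {z : EuclideanSpace ℝ (Fin n) × ℝ} (hz : z ∈ Ω)
    {ρ t₁ t₂ A B c d K : ℝ} (hρ : 0 < ρ) (hA : 0 < A) (hB : B = (ρ ^ 2)⁻¹) (hc : 0 < c)
    (hK : A + 2 * n * B < K * (c ^ 2 / 2))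
    (hx : ‖z.1‖ < ρ) (ht₁ : t₁ < z.2) (ht₂ : z.2 ≤ t₂)
    (hφ : 0 < localizer f A B c d z)
    (hmax : ∀ y ∈ Metric.closedBall (0 : EuclideanSpace ℝ (Fin n)) ρ ×ˢ Set.Icc t₁ t₂,
      (Real.exp (K * localizer f A B c d y) - 1) * √(1 + ‖spaceGrad f y‖ ^ 2) ≤
        (Real.exp (K * localizer f A B c d z) - 1) * √(1 + ‖spaceGrad f z‖ ^ 2)) :
    √(1 + ‖spaceGrad f z‖ ^ 2) ≤ 2 + 16 / (ρ * c) := by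
  by_contra! hcon
  have h16 : 0 < 16 / (ρ * c) := by positivity
  have hB0 : 0 < B := by rw [hB]; positivity
  have hK0 : 0 < K := by
    have : 0 < K * (c ^ 2 / 2) := lt_of_le_of_lt (by positivity) hK
    exact pos_of_mul_pos_left this (by positivity)
  have hgrad := sum_dirDeriv_localizer_ge (A := A) (d := d)
    (hf.differentiableAt_of_isOpen hΩ hz) hB hc hρ hx.le (by linarith) (by linarith)
  have hheat := graphHeatOp_localizer hΩ hf hs hz A B c d
  set φ := localizer f A B c d with hφdef
  have hφs : ContDiffOn ℝ ∞ φ Ω := contDiffOn_localizer hf A B c d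
  set P := spaceGrad f z with hP
  have hP0 : 0 < ‖P‖ := by
    by_contra! h0
    have : ‖P‖ = 0 := le_antisymm h0 (norm_nonneg _)
    rw [this] at hcon
    norm_num at hcon
    linarith
  set v := √(1 + ‖P‖ ^ 2) with hv
  have hv0 : 0 < v := by linarith
  -- Freezing the gradient direction at `z` replaces `|Df|` by `w = ∂_e f`. Since `|w| ≤ |Df|` with
  -- equality at `z`, the maximum persists, and only a linear derivative of `f` has to be
  -- differentiated.
  set e := ‖P‖⁻¹ • P with he
  have hPe : P = ‖P‖ • e := by rw [he, smul_smul, mul_inv_cancel₀ hP0.ne', one_smul]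
  have hen : ‖e‖ = 1 := by rw [he, norm_smul, norm_inv, norm_norm, inv_mul_cancel₀ hP0.ne']
  have hinv := graphHeatOp_inv_sqrt_nonneg hΩ hf hs hz (c := e) hPe hen
  set w := dirDeriv (e, (0 : ℝ)) f with hw
  have hws : ContDiffOn ℝ ∞ w Ω := hf.contDiffOn_dirDeriv hΩ _
  have hqs : ContDiffOn ℝ ∞ (fun y => (√(1 + w y ^ 2))⁻¹) Ω :=
    contDiff_inv_sqrt_one_add_sq.comp_contDiffOn hws
  have hwz : w z = ‖P‖ := by
    rw [hw, dirDeriv_space_eq_inner, ← hP, hPe, inner_smul_right, real_inner_self_eq_norm_sq, hen,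
      ← hPe]
    simp
  have hηs : ContDiffOn ℝ ∞ (fun y => Real.exp (K * φ y) - 1) Ω :=
    (Real.contDiff_exp.comp_contDiffOn (contDiffOn_const.mul hφs)).sub contDiffOn_const
  set lam := (Real.exp (K * φ z) - 1) * v with hlam
  have hη0 : 0 < Real.exp (K * φ z) - 1 := by
    have := Real.one_lt_exp_iff.2 (mul_pos hK0 hφ)
    linarith
  have hlam0 : 0 < lam := mul_pos hη0 hv0
  have hmaxY := heatOp_nonneg_of_isMaxOn hΩ
    (f := fun y => (Real.exp (K * φ y) - 1) - lam * (√(1 + w y ^ 2))⁻¹)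
    (hηs.sub (contDiffOn_const.mul hqs)) hz hx ht₁ ht₂ (Eventually.of_forall fun y hy => by
      have h0 : (Real.exp (K * φ z) - 1) - lam * (√(1 + w z ^ 2))⁻¹ = 0 := by
        rw [hwz, ← hv, hlam]; field_simp; ring
      rw [h0]
      have hwy : w y ^ 2 ≤ ‖spaceGrad f y‖ ^ 2 := by
        have h1 : |w y| ≤ ‖e‖ * ‖spaceGrad f y‖ := by
          rw [hw, dirDeriv_space_eq_inner]; exact abs_real_inner_le_norm _ _
        rw [hen, one_mul] at h1
        rw [← sq_abs]
        gcongr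
      have hsw : 0 < √(1 + w y ^ 2) := Real.sqrt_pos.2 (by positivity)
      rw [sub_nonpos, ← div_eq_mul_inv, le_div_iff₀ hsw]
      rcases le_or_gt (Real.exp (K * φ y) - 1) 0 with h1 | h1
      · nlinarith
      · refine le_trans ?_ (hmax y hy)
        gcongr) (graphFrame P)
  rw [heatOp_sub hΩ hηs (contDiffOn_const.mul hqs) hz, heatOp_const_mul hΩ hqs hz,
    heatOp_comp hΩ hφs (g := fun s => Real.exp (K * s) - 1)
      (g' := fun s => K * Real.exp (K * s)) (g'' := K ^ 2 * Real.exp (K * φ z)) hz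
      (fun s => by
        have := (((hasDerivAt_id s).const_mul K).exp).sub_const 1
        refine this.congr_deriv ?_
        simp [mul_comm])
      (by
        have := (((hasDerivAt_id (φ z)).const_mul K).exp).const_mul K
        refine this.congr_deriv ?_
        simp only [id_eq]
        ring)] at hmaxY
  unfold graphHeatOp at hheat hinv
  rw [hheat] at hmaxY
  have h1 : A + B * (2 * (n - ‖P‖ ^ 2 / (1 + ‖P‖ ^ 2))) ≤ A + 2 * n * B := by
    have : 0 ≤ B * (‖P‖ ^ 2 / (1 + ‖P‖ ^ 2)) := by positivity
    linarith
  set G := ∑ k, dirDeriv (graphFrame P k, (0 : ℝ)) φ z ^ 2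
  have h2 : K * (c ^ 2 / 2) ≤ K * G := by gcongr
  have h3 := mul_nonneg hlam0.le hinv
  have hE : 0 < K * Real.exp (K * φ z) := by positivity
  have h4 : A + B * (2 * (n - ‖P‖ ^ 2 / (1 + ‖P‖ ^ 2))) - K * G < 0 := by linarith
  -- The cutoff is a strict subsolution at `z` and `lam / √(1 + w²)` a supersolution, contradicting
  -- `hmaxY`.
  have h5 := mul_neg_of_pos_of_neg hE h4
  nlinarith

theorem interior_gradient_estimate {f : EuclideanSpace ℝ (Fin n) × ℝ → ℝ}
    {Ω : Set (EuclideanSpace ℝ (Fin n) × ℝ)} (hΩ : IsOpen Ω) (hf : ContDiffOn ℝ ∞ f Ω)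
    (hs : SolvesGraphEquation f Ω) {ρ t₁ t₂ m K : ℝ} (hρ : 0 < ρ) (ht : t₁ < t₂) (hm : 0 < m)
    (hsub : Metric.closedBall (0 : EuclideanSpace ℝ (Fin n)) ρ ×ˢ Set.Icc t₁ t₂ ⊆ Ω)
    (hosc : ∀ y ∈ Metric.closedBall (0 : EuclideanSpace ℝ (Fin n)) ρ ×ˢ Set.Icc t₁ t₂,
      |f y - f (0, t₂)| ≤ m)
    (hK : 8 * m ^ 2 * ((t₂ - t₁)⁻¹ + 2 * n * (ρ ^ 2)⁻¹) < K) :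
    (Real.exp (K / 2) - 1) * √(1 + ‖spaceGrad f (0, t₂)‖ ^ 2) ≤
      Real.exp K * (2 + 32 * m / ρ) := by
  set Q := Metric.closedBall (0 : EuclideanSpace ℝ (Fin n)) ρ ×ˢ Set.Icc t₁ t₂ with hQ
  have hQc : IsCompact Q := (isCompact_closedBall _ _).prod isCompact_Icc
  have hA : 0 < (t₂ - t₁)⁻¹ := inv_pos.2 (by linarith)
  set A := (t₂ - t₁)⁻¹ with hAdef
  have hAt : A * (t₂ - t₁) = 1 := inv_mul_cancel₀ (by linarith)
  set B := (ρ ^ 2)⁻¹ with hB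
  have hBρ : B * ρ ^ 2 = 1 := inv_mul_cancel₀ (by positivity)
  set c := (2 * m)⁻¹ with hc
  have hcm : c * m = 1 / 2 := by rw [hc]; field_simp
  have hc0 : 0 < c := by positivity
  -- With these constants `φ ≤ 0` on the bottom and the side of the cylinder, `φ ≤ 1` throughout,
  -- and `φ = 1/2` at `(0, t₂)`. So the maximum of `η` is positive and is attained off the bottom
  -- and the side.
  set d := -A * t₁ - 1 / 2 + c * f (0, t₂) with hd
  set φ := localizer f A B c d with hφ
  have hφeq : ∀ y, φ y = A * (y.2 - t₁) - B * ‖y.1‖ ^ 2 - 1 / 2 - c * (f y - f (0, t₂)) := by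
    intro y; rw [hφ, localizer, hd]; ring
  have hB0 : 0 < B := by positivity
  have hcf : ∀ y ∈ Q, |c * (f y - f (0, t₂))| ≤ 1 / 2 := by
    intro y hy
    rw [abs_mul, abs_of_pos hc0, ← hcm]
    gcongr
    exact hosc y hy
  have hK0 : 0 < K := lt_of_le_of_lt (by positivity) hK
  set η : EuclideanSpace ℝ (Fin n) × ℝ → ℝ := fun y =>
    (Real.exp (K * φ y) - 1) * √(1 + ‖spaceGrad f y‖ ^ 2) with hη
  have hcont : ContinuousOn η Q := by
    have h1 : ContinuousOn φ Q := ((contDiffOn_localizer hf A B c d).continuousOn).mono hsub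
    have h2 : ContinuousOn (fun y => 1 + ‖spaceGrad f y‖ ^ 2) Q := by
      simp only [norm_spaceGrad_sq]
      exact continuousOn_const.add (continuousOn_finsetSum _ fun i _ =>
        (((hf.contDiffOn_dirDeriv hΩ (spaceDir i)).continuousOn).mono hsub).pow 2)
    exact (((continuousOn_const.mul h1).rexp).sub continuousOn_const).mul h2.sqrt
  have hpQ : ((0 : EuclideanSpace ℝ (Fin n)), t₂) ∈ Q := ⟨by simpa using hρ.le, ht.le, le_rfl⟩
  obtain ⟨z, hzQ, hzmax⟩ := hQc.exists_isMaxOn ⟨_, hpQ⟩ hcont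
  have hzmax' : ∀ y ∈ Q, η y ≤ η z := fun y hy => hzmax hy
  have hφp : φ (0, t₂) = 1 / 2 := by rw [hφeq]; simp; linarith
  have hηp : η (0, t₂) = (Real.exp (K / 2) - 1) * √(1 + ‖spaceGrad f (0, t₂)‖ ^ 2) := by
    simp only [hη, hφp]; ring_nf
  rw [← hηp]
  refine (hzmax' _ hpQ).trans ?_
  have hv : ∀ y, 0 < √(1 + ‖spaceGrad f y‖ ^ 2) := fun y => Real.sqrt_pos.2 (by positivity)
  have hφz : 0 < φ z := by
    by_contra! hneg
    have h1 : η z ≤ 0 := mul_nonpos_of_nonpos_of_nonneg (by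
      have := Real.exp_le_one_iff.2 (mul_nonpos_of_nonneg_of_nonpos hK0.le hneg)
      linarith) (hv z).le
    have h2 : 0 < η (0, t₂) := by
      rw [hηp]
      refine mul_pos ?_ (hv _)
      have := Real.one_lt_exp_iff.2 (half_pos hK0)
      linarith
    linarith [hzmax' _ hpQ]
  have hz1 : ‖z.1‖ ≤ ρ := by simpa using hzQ.1
  have hz2 := hzQ.2
  have hzc := abs_le.1 (hcf z hzQ)
  have hAz : A * (z.2 - t₁) ≤ 1 := by rw [← hAt]; gcongr; exact hz2.2
  have hBz : 0 ≤ B * ‖z.1‖ ^ 2 := by positivity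
  rw [hφeq] at hφz
  have hx : ‖z.1‖ < ρ := by
    refine lt_of_le_of_ne hz1 fun heq => ?_
    rw [heq] at hφz
    linarith
  have ht₁ : t₁ < z.2 := by
    refine lt_of_le_of_ne hz2.1 fun heq => ?_
    rw [← heq, sub_self, mul_zero] at hφz
    linarith
  have hbound := gradient_bound_of_isMaxOn hΩ hf hs (hsub hzQ) (d := d) hρ hA hB hc0
    (K := K) (by
      have : c ^ 2 / 2 = 1 / (8 * m ^ 2) := by rw [hc]; field_simp; norm_num
      rw [this, mul_one_div, lt_div_iff₀ (by positivity)]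
      linarith) hx ht₁ hz2.2 (by rw [← hφ, hφeq]; exact hφz) hzmax'
  have h32 : 16 / (ρ * c) = 32 * m / ρ := by rw [hc]; field_simp; norm_num
  rw [h32] at hbound
  have hφ1 : φ z ≤ 1 := by rw [hφeq]; linarith
  refine mul_le_mul ?_ hbound (hv z).le (Real.exp_pos _).le
  have : Real.exp (K * φ z) ≤ Real.exp K := Real.exp_le_exp.2 (by nlinarith)
  linarith

end GradientEstimate

/-! ### Choice of constants and conclusion -/

theorem theorem1p1 (n : ℕ) (hn : 1 ≤ n) :
    ∃ C : ℝ, ∀ (r : ℝ) (_ : 0 < r) (u : EuclideanSpace ℝ (Fin n) → ℝ → ℝ),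
      GraphFlowsByMeanCurvature
        (Metric.ball (0 : EuclideanSpace ℝ (Fin n)) (Real.sqrt (2 * (n : ℝ) + 1) * r)) (r ^ 2) u →
      BddAbove ((fun x => |u x 0|) ''
        Metric.ball (0 : EuclideanSpace ℝ (Fin n)) (Real.sqrt (2 * (n : ℝ) + 1) * r)) →
      Real.log ‖gradient (fun x => u x (r ^ 2 / (4 * (n : ℝ)))) 0‖ ≤
        C * (1 + r⁻¹ * supNormOn
          (Metric.ball (0 : EuclideanSpace ℝ (Fin n)) (Real.sqrt (2 * (n : ℝ) + 1) * r))
          (fun x => u x 0)) ^ 2 := by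
  have hn' : (1 : ℝ) ≤ n := by exact_mod_cast hn
  set a := √(2 * (n : ℝ) + 1) with ha
  have ha2 : a ^ 2 = 2 * n + 1 := Real.sq_sqrt (by positivity)
  have ha0 : 0 < a := Real.sqrt_pos.2 (by positivity)
  have ha1 : 3 / 2 < a := by nlinarith
  refine ⟨800 * n + 98, fun r hr u hu hbdd => ?_⟩
  set M := supNormOn (Metric.ball (0 : EuclideanSpace ℝ (Fin n)) (a * r)) (fun x => u x 0) with hM
  have hinit : ∀ x ∈ Metric.ball (0 : EuclideanSpace ℝ (Fin n)) (a * r), |u x 0| ≤ M :=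
    fun x hx => le_csSup hbdd ⟨x, hx, rfl⟩
  have har : 0 < a * r := mul_pos ha0 hr
  have hM0 : 0 ≤ M := (abs_nonneg _).trans (hinit 0 (Metric.mem_ball_self har))
  set X := 1 + r⁻¹ * M with hX
  have hX1 : 1 ≤ X := by
    have : 0 ≤ r⁻¹ * M := by positivity
    linarith
  have hrX : r * X = r + M := by rw [hX]; field_simp
  set t₂ := r ^ 2 / (4 * (n : ℝ)) with ht₂
  have ht₂0 : 0 < t₂ := by positivity
  have hnt : 4 * n * t₂ = r ^ 2 := by rw [ht₂]; field_simp
  have ht₂r : t₂ < r ^ 2 := by nlinarith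
  -- Barriers of radius `R₀ = 3r/2 < a r` suffice: `r² + 2n t₂ = 3r²/2 < 9r²/4`.
  have hsup : ∀ {x : EuclideanSpace ℝ (Fin n)} {t : ℝ}, ‖x‖ ≤ r → t ∈ Set.Icc 0 t₂ →
      |u x t| < M + 3 / 2 * r := fun hx ht =>
    abs_lt_of_sphere_barriers hu (by positivity) (by gcongr) ht₂r hinit (ρ := r)
      (by nlinarith) hx ht
  set f : EuclideanSpace ℝ (Fin n) × ℝ → ℝ := fun z => u z.1 z.2 with hf
  have hΩ := isOpen_cylinder
    (Metric.isOpen_ball (x := (0 : EuclideanSpace ℝ (Fin n))) (ε := a * r)) (r ^ 2)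
  have hra : r < a * r := by nlinarith
  have hgrad : gradient (fun x => u x t₂) 0 = spaceGrad f (0, t₂) :=
    gradient_slice (hu.smooth.differentiableAt_of_isOpen hΩ
      ⟨Metric.mem_ball_self har, ht₂0, ht₂r⟩)
  rw [hgrad]
  -- Starting at `t₂ / 2` keeps the cylinder inside the region of smoothness. The oscillation is at
  -- most `2M + 3r ≤ 3rX`, and the threshold for `K` is then `720 n X²`.
  have hkey := interior_gradient_estimate hΩ hu.smooth
    (hu.solvesGraphEquation Metric.isOpen_ball) (ρ := r) (t₁ := t₂ / 2) (t₂ := t₂)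
    (m := 3 * (r * X)) (K := 800 * n * X ^ 2) hr (by linarith) (by positivity)
    (Set.prod_mono (Metric.closedBall_subset_ball hra) fun s hs =>
      ⟨by linarith [hs.1], by linarith [hs.2]⟩)
    (fun y hy => by
      have h1 := abs_lt.1 (hsup (x := y.1) (t := y.2) (by simpa using hy.1)
        ⟨by linarith [hy.2.1], hy.2.2⟩)
      have h2 := abs_lt.1 (hsup (x := 0) (t := t₂) (by simpa using hr.le) ⟨ht₂0.le, le_rfl⟩)
      rw [hrX]
      exact abs_le.2 ⟨by linarith, by linarith⟩)
    (by
      have h1 : (t₂ - t₂ / 2)⁻¹ = 8 * n / r ^ 2 := by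
        rw [ht₂]; field_simp; norm_num
      have h2 : 8 * (3 * (r * X)) ^ 2 * (8 * n / r ^ 2 + 2 * n * (r ^ 2)⁻¹) = 720 * n * X ^ 2 := by
        field_simp; norm_num
      rw [h1, h2]
      have : 0 < n * X ^ 2 := by positivity
      linarith)
  set p := ‖spaceGrad f (0, t₂)‖ with hp
  rcases (norm_nonneg (spaceGrad f (0, t₂))).eq_or_lt with h0 | h0
  -- As `Real.log 0 = 0`, a vanishing gradient only requires a nonnegative right-hand side.
  · rw [hp, ← h0, Real.log_zero]
    positivity
  set K := 800 * n * X ^ 2 with hK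
  have hK2 : 2 ≤ K := by nlinarith [one_le_pow₀ hX1 (n := 2)]
  have hV : 2 + 32 * (3 * (r * X)) / r ≤ 98 * X := by
    have : 32 * (3 * (r * X)) / r = 96 * X := by field_simp; norm_num
    rw [this]; linarith
  have hpv : p ≤ √(1 + p ^ 2) := Real.le_sqrt_of_sq_le (by linarith)
  have hexp : 1 ≤ Real.exp (K / 2) - 1 := by
    have := Real.add_one_le_exp (K / 2)
    linarith
  have hpK : p ≤ Real.exp K * (98 * X) :=
    calc p ≤ √(1 + p ^ 2) := hpv
      _ ≤ (Real.exp (K / 2) - 1) * √(1 + p ^ 2) :=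
        le_mul_of_one_le_left (Real.sqrt_nonneg _) hexp
      _ ≤ _ := hkey
      _ ≤ _ := by gcongr
  calc Real.log p ≤ Real.log (Real.exp K * (98 * X)) := Real.log_le_log h0 hpK
    _ = K + Real.log (98 * X) := by
      rw [Real.log_mul (Real.exp_pos _).ne' (by positivity), Real.log_exp]
    _ ≤ K + 98 * X := by
      gcongr
      exact Real.log_le_self (by positivity)
    _ ≤ (800 * n + 98) * X ^ 2 := by nlinarith
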